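/- Fix integers $k,m\ge 0$. Suppose we have access to an oracle which, given rational numbers $a_{ij}$ (as fractions) and non-negative integers $\alpha_{ij}$ (in binary), $1\le i\le k$, $1\le j\le m+1$, decides whether $$\sum_{i=1}^k\prod_{j=1}^{m+1}a_{ij}^{\alpha_{ij}}=0 .$$ Then there are a deterministic algorithm with this oracle and a polynomial $Q$, both depending only on $k$ and $m$, with the following property. The input consists of non-zero univariate polynomials $f_1,\dots,f_m\in\mathbb Q[X]$ in sparse representation (each $f_j$ is given as the list, in any order, of its monomials with non-zero coefficient, where coefficients are fractions of integers and exponents are integers, all written in binary), and of non-negative integers $\alpha_{ij}$ ($1\le i\le k$, $1\le j\le m$) written in binary. The algorithm decides whether the polynomial $$\phi=\sum_{i=1}^k\prod_{j=1}^m f_j^{\alpha_{ij}}$$ is identically zero. If every $f_j$ has at most $t$ monomials, and if the numerators and denominators of the coefficients and the exponents of all $f_j$, and all the $\alpha_{ij}$, have at most $s$ binary digits, then the running time (in bit cost, i.e. every elementary operation on integers or pairs is charged at least the bit length of its operands, and an oracle query the bit length of the query) is at most $Q(t+s)$. -/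

import Mathlib

open scoped BigOperators

/-! ## Machine model

A deterministic oracle machine with bit cost: structured programs over finitely many variables.
Each variable stores an integer or a finite binary tree with integers at its leaves. Every primitive
operation is charged at least the total number of bits of its operands (multiplication: the product
of the two lengths), so that the cost is polynomially related to the running time of an oracle
Turing machine. -/

/-- Values stored in a variable: integers and ordered pairs of values. -/
inductive Val : Type
  | num (z : ℤ) : Val
  | pair (a b : Val) : Val

namespace Val

/-- The bit length of a value; an integer takes its binary digits and a sign. -/
def size : Val → ℕ
  | num z => z.natAbs.size + 1
  | pair a b => a.size + b.size + 1

def toInt : Val → ℤ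
  | num z => z
  | pair _ _ => 0

def fst : Val → Val
  | num _ => num 0
  | pair a _ => a

def snd : Val → Val
  | num _ => num 0
  | pair _ b => b

def isPair : Val → Bool
  | num _ => false
  | pair _ _ => true

/-- The test used by conditionals and loops: only the integer `0` counts as false. -/
def truthy : Val → Bool
  | num z => decide (z ≠ 0)
  | pair _ _ => true

def ofBool (b : Bool) : Val := num (if b then 1 else 0)

/-- A list `[v₁, …, vₙ]` is stored as `(v₁, (v₂, … (vₙ, 0)))`. -/
def ofList : List Val → Val
  | [] => num 0
  | v :: l => pair v (ofList l)

end Val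

/-- The contents of the variables `0, 1, 2, …`; a program mentions only finitely many of them. -/
abbrev Store : Type := ℕ → Val

inductive Expr : Type
  | var (x : ℕ) : Expr
  | const (z : ℤ) : Expr
  | pair (e₁ e₂ : Expr) : Expr
  | fst (e : Expr) : Expr
  | snd (e : Expr) : Expr
  | isPair (e : Expr) : Expr
  | pos (e : Expr) : Expr
  | add (e₁ e₂ : Expr) : Expr
  | sub (e₁ e₂ : Expr) : Expr
  | mul (e₁ e₂ : Expr) : Expr

namespace Expr

def eval (σ : Store) : Expr → Val
  | var x => σ x
  | const z => Val.num z
  | pair e₁ e₂ => Val.pair (e₁.eval σ) (e₂.eval σ)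
  | fst e => (e.eval σ).fst
  | snd e => (e.eval σ).snd
  | isPair e => Val.ofBool (e.eval σ).isPair
  | pos e => Val.ofBool (decide (0 < (e.eval σ).toInt))
  | add e₁ e₂ => Val.num ((e₁.eval σ).toInt + (e₂.eval σ).toInt)
  | sub e₁ e₂ => Val.num ((e₁.eval σ).toInt - (e₂.eval σ).toInt)
  | mul e₁ e₂ => Val.num ((e₁.eval σ).toInt * (e₂.eval σ).toInt)

/-- The bit cost of evaluating an expression. -/
def cost (σ : Store) : Expr → ℕ
  | var x => (σ x).size
  | const z => (Val.num z).size
  | pair e₁ e₂ => e₁.cost σ + e₂.cost σ + ((e₁.eval σ).size + (e₂.eval σ).size + 1)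
  | fst e => e.cost σ + (e.eval σ).size
  | snd e => e.cost σ + (e.eval σ).size
  | isPair e => e.cost σ + (e.eval σ).size
  | pos e => e.cost σ + (e.eval σ).size
  | add e₁ e₂ => e₁.cost σ + e₂.cost σ + ((e₁.eval σ).size + (e₂.eval σ).size)
  | sub e₁ e₂ => e₁.cost σ + e₂.cost σ + ((e₁.eval σ).size + (e₂.eval σ).size)
  | mul e₁ e₂ => e₁.cost σ + e₂.cost σ + (e₁.eval σ).size * (e₂.eval σ).size

end Expr

/-- Programs. `query x e` hands the value of `e` to the oracle and stores the answer in `x`. -/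
inductive Prog : Type
  | skip : Prog
  | assign (x : ℕ) (e : Expr) : Prog
  | query (x : ℕ) (e : Expr) : Prog
  | seq (p q : Prog) : Prog
  | ite (e : Expr) (p q : Prog) : Prog
  | while (e : Expr) (p : Prog) : Prog

/-- `Exec O p σ σ' T`: with oracle `O`, the program `p` started on `σ` halts on `σ'` after time
exactly `T`. -/
inductive Exec (O : Val → Bool) : Prog → Store → Store → ℕ → Prop
  | skip (σ : Store) : Exec O Prog.skip σ σ 1
  | assign (x : ℕ) (e : Expr) (σ : Store) :
      Exec O (Prog.assign x e) σ (Function.update σ x (e.eval σ)) (e.cost σ + 1)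
  | query (x : ℕ) (e : Expr) (σ : Store) :
      Exec O (Prog.query x e) σ (Function.update σ x (Val.ofBool (O (e.eval σ))))
        (e.cost σ + (e.eval σ).size + 1)
  | seq {p q : Prog} {σ₁ σ₂ σ₃ : Store} {T₁ T₂ : ℕ} :
      Exec O p σ₁ σ₂ T₁ → Exec O q σ₂ σ₃ T₂ → Exec O (Prog.seq p q) σ₁ σ₃ (T₁ + T₂)
  | ite_true {e : Expr} {p q : Prog} {σ σ' : Store} {T : ℕ} :
      (e.eval σ).truthy = true → Exec O p σ σ' T →
      Exec O (Prog.ite e p q) σ σ' (e.cost σ + 1 + T)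
  | ite_false {e : Expr} {p q : Prog} {σ σ' : Store} {T : ℕ} :
      (e.eval σ).truthy = false → Exec O q σ σ' T →
      Exec O (Prog.ite e p q) σ σ' (e.cost σ + 1 + T)
  | while_true {e : Expr} {p : Prog} {σ₁ σ₂ σ₃ : Store} {T₁ T₂ : ℕ} :
      (e.eval σ₁).truthy = true → Exec O p σ₁ σ₂ T₁ → Exec O (Prog.while e p) σ₂ σ₃ T₂ →
      Exec O (Prog.while e p) σ₁ σ₃ (e.cost σ₁ + 1 + T₁ + T₂)
  | while_false {e : Expr} {p : Prog} {σ : Store} :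
      (e.eval σ).truthy = false → Exec O (Prog.while e p) σ σ (e.cost σ + 1)

/-- The machine is deterministic: the final store and the running time are unique. -/
theorem Exec.deterministic {O : Val → Bool} {p : Prog} {σ σ₁ σ₂ : Store} {T₁ T₂ : ℕ}
    (h₁ : Exec O p σ σ₁ T₁) (h₂ : Exec O p σ σ₂ T₂) : σ₁ = σ₂ ∧ T₁ = T₂ := by
  induction h₁ generalizing σ₂ T₂ with
  | skip => cases h₂; exact ⟨rfl, rfl⟩
  | assign => cases h₂; exact ⟨rfl, rfl⟩
  | query => cases h₂; exact ⟨rfl, rfl⟩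
  | seq _ _ ih₁ ih₂ =>
    cases h₂ with
    | seq a b =>
      obtain ⟨rfl, rfl⟩ := ih₁ a
      obtain ⟨rfl, rfl⟩ := ih₂ b
      exact ⟨rfl, rfl⟩
  | ite_true h _ ih =>
    cases h₂ with
    | ite_true _ a => obtain ⟨rfl, rfl⟩ := ih a; exact ⟨rfl, rfl⟩
    | ite_false h' _ => simp [h] at h'
  | ite_false h _ ih =>
    cases h₂ with
    | ite_true h' _ => simp [h] at h'
    | ite_false _ a => obtain ⟨rfl, rfl⟩ := ih a; exact ⟨rfl, rfl⟩
  | while_true h _ _ ih₁ ih₂ =>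
    cases h₂ with
    | while_true _ a b =>
      obtain ⟨rfl, rfl⟩ := ih₁ a
      obtain ⟨rfl, rfl⟩ := ih₂ b
      exact ⟨rfl, rfl⟩
    | while_false h' => simp [h] at h'
  | while_false h =>
    cases h₂ with
    | while_true h' _ _ => simp [h] at h'
    | while_false _ => exact ⟨rfl, rfl⟩

/-- The initial store: the input is in variable `0`, all other variables are `0`. -/
def Store.init (input : Val) : Store := fun x => if x = 0 then input else Val.num 0

/-! ## Rational numbers and sparse polynomials as inputs -/

/-- A rational number written as a fraction, not necessarily in lowest terms. -/
structure Frac : Type where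
  num : ℤ
  den : ℕ
  den_pos : 0 < den

namespace Frac

def toRat (a : Frac) : ℚ := (a.num : ℚ) / (a.den : ℚ)

def encode (a : Frac) : Val := Val.pair (Val.num a.num) (Val.num a.den)

/-- Numerator and denominator have at most `s` binary digits. -/
def BitsizeLE (a : Frac) (s : ℕ) : Prop := a.num.natAbs.size ≤ s ∧ a.den.size ≤ s

end Frac

/-- A list of monomials, each an exponent and a coefficient. -/
abbrev SparseRep : Type := List (ℕ × Frac)

namespace SparseRep

noncomputable def toPoly (L : SparseRep) : Polynomial ℚ :=
  (L.map fun c => Polynomial.monomial c.1 c.2.toRat).sum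

/-- `L` lists, in any order, the monomials of `f` with a nonzero coefficient, each one once. -/
def Represents (L : SparseRep) (f : Polynomial ℚ) : Prop :=
  (L.map Prod.fst).Nodup ∧ (∀ c ∈ L, c.2.toRat ≠ 0) ∧ L.toPoly = f

/-- Exponents are written in binary. -/
def encode (L : SparseRep) : Val :=
  Val.ofList (L.map fun c => Val.pair (Val.num c.1) c.2.encode)

/-- All exponents, and the numerators and denominators of all coefficients, have at most `s`
binary digits. -/
def BitsizeLE (L : SparseRep) (s : ℕ) : Prop :=
  ∀ c ∈ L, c.1.size ≤ s ∧ c.2.BitsizeLE s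

end SparseRep

/-- The input that describes `∑ i, ∏ j, f j ^ α i j`: the list of the `f j` in sparse
representation, and the rows of the exponents `α i j` in binary. -/
def encodeInput {k m : ℕ} (L : Fin m → SparseRep) (α : Fin k → Fin m → ℕ) : Val :=
  Val.pair (Val.ofList (List.ofFn fun j => (L j).encode))
    (Val.ofList (List.ofFn fun i => Val.ofList (List.ofFn fun j => Val.num (α i j))))

/-! ## The oracle -/

/-- The query that describes `∑ i, ∏ j, a i j ^ α i j`: rows of pairs `(a i j, α i j)`. -/
def encodeQuery {k n : ℕ} (a : Fin k → Fin n → Frac) (α : Fin k → Fin n → ℕ) : Val :=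
  Val.ofList (List.ofFn fun i =>
    Val.ofList (List.ofFn fun j => Val.pair (a i j).encode (Val.num (α i j))))

/-- `O` decides the constant identities `∑_{i ≤ k} ∏_{j ≤ n} a i j ^ α i j = 0` with rational
`a i j` and natural exponents `α i j`. Nothing is known about its answers to other queries. -/
def DecidesConstantIdentities (k n : ℕ) (O : Val → Bool) : Prop :=
  ∀ (a : Fin k → Fin n → Frac) (α : Fin k → Fin n → ℕ),
    O (encodeQuery a α) = true ↔ ∑ i, ∏ j, (a i j).toRat ^ α i j = 0

/-!
The identity `∑ i, g i = 0`, with `g i = ∏ j, f j ^ α i j`, is decided without expanding the powers.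
All derivatives are taken with respect to the derivation `θ = X * d/dX` (`eulerOp`), which maps sparse
polynomials to sparse polynomials and whose constants on quotients of polynomials are the rationals.

The `l`-th derivative of `g i` is `g i * H i l / (∏ j, f j) ^ l`, where `H i l` (`derivFactor`) is a
polynomial expression of fixed shape in the `f j`, their derivatives and the `α i j`. Hence the
Wronskian of a subfamily of the `g i` is, up to nonzero factors, a determinant of some of the `H i l`
(`sparseWronskian`), which can be computed in polynomial time because `k` and `m` are fixed. A
subfamily `s` is a basis of the span of the `g i` over `ℚ` if its Wronskian does not vanish while all
Wronskians with one more member do (`exists_eq_sum_of_wronskian`). By Cramer's rule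
(`wronskian_update`), the coefficient `c i a` of `g i` at the basis element `g (s a)` satisfies
`g i * D (s with s a replaced by i) = c i a * g (s a) * D s`, where `D` is the sparse Wronskian. Leading
coefficients are multiplicative, so that `∑ i, c i a = 0` becomes
`∑ i, (∏ j, lc (f j) ^ α i j) * lc (D (s with s a replaced by i)) = 0`
(`IsWronskianBasis.sum_eq_zero_iff`), an identity of the kind that the oracle decides. The last factor,
with exponent `1`, accounts for the `(m + 1)`-st column of the query. Since the basis is linearly
independent, `∑ i, g i = 0` if and only if these identities hold for all `a`.

On the side of the machine, `PolyTime` is the class of functions on values computed by a program in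
polynomial time. It is closed under composition, pairing, branching, oracle queries and folds over
lists with results of polynomial size (`PolyTime.foldl`). This gives the arithmetic of sparse
polynomials, and the maps from instances to sparse polynomials computable in polynomial time
(`SparsePolyTime`) form a ring closed under `θ`, which contains the determinants above.
-/

open Val

/-! ### Polynomial-time functions of the machine -/

theorem Polynomial.eval_nat_mono (P : Polynomial ℕ) {a b : ℕ} (h : a ≤ b) :
    P.eval a ≤ P.eval b := by
  simp only [Polynomial.eval_eq_sum, Polynomial.sum]
  gcongr

theorem Nat.size_mul_le (a b : ℕ) : (a * b).size ≤ a.size + b.size := by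
  rw [Nat.size_le, pow_add]
  exact Nat.mul_lt_mul'' (Nat.lt_size_self a) (Nat.lt_size_self b)

theorem Nat.size_add_le (a b : ℕ) : (a + b).size ≤ max a.size b.size + 1 := by
  rw [Nat.size_le, pow_succ]
  have ha := (Nat.lt_size_self a).trans_le
    (Nat.pow_le_pow_right (n := 2) (by norm_num) (le_max_left a.size b.size))
  have hb := (Nat.lt_size_self b).trans_le
    (Nat.pow_le_pow_right (n := 2) (by norm_num) (le_max_right a.size b.size))
  omega

namespace Val

@[simp] theorem fst_pair (a b : Val) : (pair a b).fst = a := rfl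

@[simp] theorem snd_pair (a b : Val) : (pair a b).snd = b := rfl

@[simp] theorem toInt_num (z : ℤ) : (num z).toInt = z := rfl

theorem size_fst_le (v : Val) : v.fst.size ≤ v.size := by
  cases v
  · simp [size, fst]
  · simp only [size, fst]; omega

theorem size_snd_le (v : Val) : v.snd.size ≤ v.size := by
  cases v
  · simp [size, snd]
  · simp only [size, snd]; omega

theorem size_toInt_le (v : Val) : v.toInt.natAbs.size + 1 ≤ v.size := by
  cases v with
  | num z => simp [size, toInt]
  | pair a b => simp [size, toInt]

theorem size_ofBool_le (b : Bool) : (ofBool b).size ≤ 2 := by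
  cases b <;> simp [ofBool, size]

@[simp] theorem truthy_ofBool (b : Bool) : (ofBool b).truthy = b := by
  cases b <;> simp [ofBool, truthy]

theorem size_num_add_le (a b : ℤ) :
    (num (a + b)).size ≤ max a.natAbs.size b.natAbs.size + 2 := by
  have := Nat.size_le_size (Int.natAbs_add_le a b)
  have := Nat.size_add_le a.natAbs b.natAbs
  simp only [size]; omega

theorem size_num_sub_le (a b : ℤ) :
    (num (a - b)).size ≤ max a.natAbs.size b.natAbs.size + 2 := by
  have := size_num_add_le a (-b)
  rwa [Int.natAbs_neg, ← sub_eq_add_neg] at this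

theorem size_num_mul_le (a b : ℤ) :
    (num (a * b)).size ≤ a.natAbs.size + b.natAbs.size + 1 := by
  have := Nat.size_mul_le a.natAbs b.natAbs
  simp only [size, Int.natAbs_mul]; omega

/-- The list stored in a value; whatever stands at the end of the list is ignored. -/
def toList : Val → List Val
  | num _ => []
  | pair a b => a :: toList b

@[simp] theorem toList_ofList (l : List Val) : (ofList l).toList = l := by
  induction l with
  | nil => rfl
  | cons a l ih => simp [ofList, toList, ih]

theorem length_toList_le (v : Val) : v.toList.length ≤ v.size := by
  induction v with
  | num z => simp [toList]
  | pair a b _ ih => simp only [toList, List.length_cons, size]; omega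

theorem size_le_of_mem_toList {v x : Val} (h : x ∈ v.toList) : x.size ≤ v.size := by
  induction v with
  | num z => simp [toList] at h
  | pair a b _ ih =>
    simp only [toList, List.mem_cons] at h
    simp only [size]
    rcases h with rfl | h
    · omega
    · have := ih h; omega

theorem size_ofList (l : List Val) : (ofList l).size = (l.map fun v => v.size + 1).sum + 1 := by
  induction l with
  | nil => simp [ofList, size]
  | cons a l ih => simp only [ofList, size, ih, List.map_cons, List.sum_cons]; omega

theorem size_ofList_toList_le (v : Val) : (ofList v.toList).size ≤ v.size := by
  induction v with
  | num z => simp [toList, ofList, size]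
  | pair a b _ ih => simp only [toList, ofList, size]; omega

end Val

/-- `PolyTime F`: some program, started with `v` in variable `0`, computes `F O v` into variable `0`
for every oracle `O`, in time polynomial in the size of `v` and with a result of polynomial size.
All variables above a fixed one are left alone, so that they can hold intermediate results of a
larger program; nothing is assumed on the other variables at the start. -/
def PolyTime (F : (Val → Bool) → Val → Val) : Prop :=
  ∃ (p : Prog) (n : ℕ) (P : Polynomial ℕ), ∀ (O : Val → Bool) (σ : Store),
    ∃ (σ' : Store) (T : ℕ), Exec O p σ σ' T ∧ σ' 0 = F O (σ 0) ∧ (∀ x, n < x → σ' x = σ x) ∧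
      T ≤ P.eval (σ 0).size ∧ (F O (σ 0)).size ≤ P.eval (σ 0).size

namespace PolyTime

variable {F G H : (Val → Bool) → Val → Val}

theorem exists_size_le (hF : PolyTime F) :
    ∃ P : Polynomial ℕ, ∀ O v, (F O v).size ≤ P.eval v.size := by
  obtain ⟨p, n, P, h⟩ := hF
  refine ⟨P, fun O v => ?_⟩
  obtain ⟨σ', T, -, -, -, -, h⟩ := h O (fun _ => v)
  exact h

/-- A single assignment to variable `0`. -/
theorem of_expr (e : Expr) (P : Polynomial ℕ) (h : ∀ O (σ : Store), e.eval σ = F O (σ 0))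
    (hc : ∀ σ : Store, e.cost σ + 1 ≤ P.eval (σ 0).size)
    (hs : ∀ O v, (F O v).size ≤ P.eval v.size) : PolyTime F := by
  refine ⟨.assign 0 e, 0, P, fun O σ => ⟨_, _, .assign 0 e σ, ?_, ?_, hc σ, hs _ _⟩⟩
  · simp [h O]
  · intro x hx
    rw [Function.update_of_ne hx.ne']

theorem id : PolyTime fun _ v => v :=
  of_expr (.var 0) (.X + 1) (by simp [Expr.eval]) (by simp [Expr.cost]) (by simp)

theorem comp (hG : PolyTime G) (hF : PolyTime F) : PolyTime fun O v => G O (F O v) := by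
  obtain ⟨p, n, P, hp⟩ := hF
  obtain ⟨q, n', P', hq⟩ := hG
  refine ⟨.seq p q, max n n', P + P'.comp P, fun O σ => ?_⟩
  obtain ⟨σ₁, T₁, e₁, r₁, f₁, t₁, s₁⟩ := hp O σ
  obtain ⟨σ₂, T₂, e₂, r₂, f₂, t₂, s₂⟩ := hq O σ₁
  rw [r₁] at r₂ t₂ s₂
  have := P'.eval_nat_mono s₁
  refine ⟨σ₂, _, .seq e₁ e₂, r₂, fun x hx => ?_, ?_, ?_⟩
  · rw [f₂ x (by omega), f₁ x (by omega)]
  · simp only [Polynomial.eval_add, Polynomial.eval_comp]; omega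
  · simp only [Polynomial.eval_add, Polynomial.eval_comp]; omega

theorem num (z : ℤ) : PolyTime fun _ _ => Val.num z :=
  of_expr (.const z) (Polynomial.C ((Val.num z).size + 1)) (by simp [Expr.eval])
    (by simp [Expr.cost]) (by simp)

theorem fst (hF : PolyTime F) : PolyTime fun O v => (F O v).fst :=
  comp (G := fun _ v => v.fst)
    (of_expr (.fst (.var 0)) (2 * .X + 1) (by simp [Expr.eval])
      (fun σ => by simp [Expr.cost, Expr.eval]; omega)
      (fun O v => by have := size_fst_le v; simp; omega)) hF

theorem snd (hF : PolyTime F) : PolyTime fun O v => (F O v).snd :=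
  comp (G := fun _ v => v.snd)
    (of_expr (.snd (.var 0)) (2 * .X + 1) (by simp [Expr.eval])
      (fun σ => by simp [Expr.cost, Expr.eval]; omega)
      (fun O v => by have := size_snd_le v; simp; omega)) hF

theorem pair (hF : PolyTime F) (hG : PolyTime G) : PolyTime fun O v => (F O v).pair (G O v) := by
  obtain ⟨p, n, P, hp⟩ := hF
  obtain ⟨q, n', P', hq⟩ := hG
  let N := max n n' + 1
  refine ⟨.seq (.assign N (.var 0)) (.seq p (.seq (.assign (N + 1) (.var 0))
    (.seq (.assign 0 (.var N)) (.seq q (.assign 0 (.pair (.var (N + 1)) (.var 0))))))), N + 1,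
    2 * .X + 4 * P + 4 * P' + 10, fun O σ => ?_⟩
  obtain ⟨σ₁, T₁, e₁, r₁, f₁, t₁, s₁⟩ := hp O (Function.update σ N (σ 0))
  have hN : N ≠ 0 := by omega
  have hN' : (0 : ℕ) ≠ N := by omega
  have hn := f₁ N (by omega)
  simp only [Function.update_self, Function.update_of_ne hN'] at r₁ t₁ s₁ hn
  obtain ⟨σ₂, T₂, e₂, r₂, f₂, t₂, s₂⟩ :=
    hq O (Function.update (Function.update σ₁ (N + 1) (σ₁ 0)) 0 (σ 0))
  have hn2 := f₂ (N + 1) (by omega)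
  rw [Function.update_of_ne (by omega), Function.update_self] at hn2
  simp only [Function.update_self] at r₂ t₂ s₂
  refine ⟨_, _, .seq (.assign _ _ _) (.seq e₁ (.seq (.assign _ _ _) (.seq (.assign _ _ _)
    (.seq (by simpa [Expr.eval, hn] using e₂) (.assign _ _ _))))), ?_, fun x hx => ?_, ?_, ?_⟩
  · simp [Expr.eval, hn2, r₁, r₂]
  · rw [Function.update_of_ne (by omega), f₂ x (by omega), Function.update_of_ne (by omega),
      Function.update_of_ne (by omega), f₁ x (by omega), Function.update_of_ne (by omega)]
  · simp [Expr.eval, Expr.cost, hn2, r₁, r₂, hn]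
    omega
  · simp [Val.size]
    omega

theorem const (v : Val) : PolyTime fun _ _ => v := by
  induction v with
  | num z => exact num z
  | pair a b ha hb => exact pair ha hb

theorem add (hF : PolyTime F) (hG : PolyTime G) :
    PolyTime fun O v => .num ((F O v).toInt + (G O v).toInt) :=
  comp (G := fun _ v => .num (v.fst.toInt + v.snd.toInt))
    (of_expr (.add (.fst (.var 0)) (.snd (.var 0))) (6 * .X + 2) (by simp [Expr.eval])
      (fun σ => by
        have := size_fst_le (σ 0); have := size_snd_le (σ 0)
        simp [Expr.cost, Expr.eval]; omega)
      (fun O v => by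
        have := size_fst_le v; have := size_snd_le v
        have := size_toInt_le v.fst; have := size_toInt_le v.snd
        have := size_num_add_le v.fst.toInt v.snd.toInt
        simp; omega)) (pair hF hG)

theorem sub (hF : PolyTime F) (hG : PolyTime G) :
    PolyTime fun O v => .num ((F O v).toInt - (G O v).toInt) :=
  comp (G := fun _ v => .num (v.fst.toInt - v.snd.toInt))
    (of_expr (.sub (.fst (.var 0)) (.snd (.var 0))) (6 * .X + 2) (by simp [Expr.eval])
      (fun σ => by
        have := size_fst_le (σ 0); have := size_snd_le (σ 0)
        simp [Expr.cost, Expr.eval]; omega)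
      (fun O v => by
        have := size_fst_le v; have := size_snd_le v
        have := size_toInt_le v.fst; have := size_toInt_le v.snd
        have := size_num_sub_le v.fst.toInt v.snd.toInt
        simp; omega)) (pair hF hG)

theorem mul (hF : PolyTime F) (hG : PolyTime G) :
    PolyTime fun O v => .num ((F O v).toInt * (G O v).toInt) :=
  comp (G := fun _ v => .num (v.fst.toInt * v.snd.toInt))
    (of_expr (.mul (.fst (.var 0)) (.snd (.var 0))) (4 * .X + .X * .X + 2) (by simp [Expr.eval])
      (fun σ => by
        have := Nat.mul_le_mul (size_fst_le (σ 0)) (size_snd_le (σ 0))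
        simp [Expr.cost, Expr.eval]; omega)
      (fun O v => by
        have := size_fst_le v; have := size_snd_le v
        have := size_toInt_le v.fst; have := size_toInt_le v.snd
        have := size_num_mul_le v.fst.toInt v.snd.toInt
        simp; omega)) (pair hF hG)

theorem pos (hF : PolyTime F) : PolyTime fun O v => .ofBool (decide (0 < (F O v).toInt)) :=
  comp (G := fun _ v => .ofBool (decide (0 < v.toInt)))
    (of_expr (.pos (.var 0)) (2 * .X + 2) (fun _ _ => rfl)
      (fun σ => by simp [Expr.cost, Expr.eval]; omega)
      (fun O v => by
        have := size_ofBool_le (decide (0 < v.toInt))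
        simp at this ⊢; omega)) hF

theorem query (hF : PolyTime F) : PolyTime fun O v => .ofBool (O (F O v)) := by
  refine comp (G := fun O v => .ofBool (O v)) ⟨.query 0 (.var 0), 0, 2 * .X + 2, fun O σ =>
    ⟨_, _, .query _ _ _, by simp [Expr.eval], fun x hx => ?_, ?_, ?_⟩⟩ hF
  · rw [Function.update_of_ne hx.ne']
  · simp [Expr.cost, Expr.eval]; omega
  · have := size_ofBool_le (O (σ 0))
    simp; omega

theorem ite (hH : PolyTime H) (hF : PolyTime F) (hG : PolyTime G) :
    PolyTime fun O v => if (H O v).truthy then F O v else G O v := by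
  suffices h : PolyTime fun O v => if v.fst.truthy then F O v.snd else G O v.snd from
    comp h (pair hH id)
  obtain ⟨p, n, P, hp⟩ := comp hF (snd id)
  obtain ⟨q, n', P', hq⟩ := comp hG (snd id)
  refine ⟨.ite (.fst (.var 0)) p q, max n n', 2 * .X + P + P' + 2, fun O σ => ?_⟩
  by_cases h : (σ 0).fst.truthy = true
  · obtain ⟨σ₁, T₁, e₁, r₁, f₁, t₁, s₁⟩ := hp O σ
    refine ⟨σ₁, _, .ite_true (by simpa [Expr.eval] using h) e₁, by simp [h, r₁],
      fun x hx => f₁ x (by omega), ?_, ?_⟩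
    · simp [Expr.cost, Expr.eval]; omega
    · simp only [h, if_true] at s₁ ⊢; simp; omega
  · obtain ⟨σ₁, T₁, e₁, r₁, f₁, t₁, s₁⟩ := hq O σ
    refine ⟨σ₁, _, .ite_false (by simpa [Expr.eval] using h) e₁, by simp [h, r₁],
      fun x hx => f₁ x (by omega), ?_, ?_⟩
    · simp [Expr.cost, Expr.eval]; omega
    · simp only [h] at s₁ ⊢; simp; omega

/-- The loop `while isPair (fst x₀) do p`, where `p` performs one step of a fold over the list in the
first component. -/
theorem exec_foldLoop {S : (Val → Bool) → Val → Val} {p : Prog} {n : ℕ} {P : Polynomial ℕ}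
    {O : Val → Bool}
    (hp : ∀ σ : Store, ∃ (σ' : Store) (T : ℕ), Exec O p σ σ' T ∧
      σ' 0 = .pair (σ 0).fst.snd (.pair (S O (.pair (σ 0).snd.fst
        (.pair (σ 0).fst.fst (σ 0).snd.snd))) (σ 0).snd.snd) ∧
      (∀ x, n < x → σ' x = σ x) ∧ T ≤ P.eval (σ 0).size) (v : Val) (M : ℕ) (w : Val) :
    ∀ (acc : Val) (σ : Store), σ 0 = .pair w (.pair acc v) →
      (∀ l, l <+: w.toList →
        (l.foldl (fun a x => S O (.pair a (.pair x v))) acc).size + v.size + w.size + 2 ≤ M) →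
      ∃ (σ' : Store) (T : ℕ), Exec O (.while (.isPair (.fst (.var 0))) p) σ σ' T ∧
        (σ' 0).snd.fst = w.toList.foldl (fun a x => S O (.pair a (.pair x v))) acc ∧
        (σ' 0).size ≤ M ∧ (∀ x, n < x → σ' x = σ x) ∧
        T ≤ (w.toList.length + 1) * (P.eval M + 3 * M + 3) := by
  induction w with
  | num z =>
    intro acc σ h0 hM
    have := hM [] (by simp)
    refine ⟨σ, _, .while_false (by simp [Expr.eval, h0, Val.fst, isPair]), ?_, ?_,
      fun _ _ => rfl, ?_⟩
    · simp [h0, toList, Val.fst, Val.snd]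
    · simp [h0, Val.size] at this ⊢
      omega
    · simp [Expr.cost, Expr.eval, h0, toList, Val.size, Val.fst] at this ⊢
      omega
  | pair x w _ ih =>
    intro acc σ h0 hM
    have h1 := hM [] (by simp)
    obtain ⟨σ₁, T₁, e₁, r₁, f₁, t₁⟩ := hp σ
    simp only [h0, Val.fst, Val.snd] at r₁ t₁
    obtain ⟨σ₂, T₂, e₂, r₂, s₂, f₂, t₂⟩ := ih _ σ₁ r₁ (fun l hl => by
      have := hM (x :: l) (by simpa [toList] using hl)
      simp only [List.foldl_cons, Val.size] at this
      omega)
    have h2 : (Val.pair (x.pair w) (acc.pair v)).size ≤ M := by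
      simp [Val.size] at h1 ⊢; omega
    have := P.eval_nat_mono h2
    refine ⟨σ₂, _, .while_true (by simp [Expr.eval, h0, Val.fst, isPair]) e₁ e₂, ?_, s₂,
      fun y hy => by rw [f₂ y hy, f₁ y hy], ?_⟩
    · simpa [toList] using r₂
    · simp only [toList, List.length_cons]
      rw [add_mul _ 1, one_mul]
      simp [Expr.cost, Expr.eval, h0, Val.fst]
      simp [Val.size] at h2
      simp [Val.size]
      omega

/-- Folding a polynomial-time step over a computed list takes polynomial time, provided that all
intermediate results have polynomial size. -/
theorem foldl {L I S : (Val → Bool) → Val → Val} (hL : PolyTime L) (hI : PolyTime I)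
    (hS : PolyTime S)
    (hb : ∃ R : Polynomial ℕ, ∀ O v l, l <+: (L O v).toList →
      (l.foldl (fun a x => S O (.pair a (.pair x v))) (I O v)).size ≤ R.eval v.size) :
    PolyTime fun O v => (L O v).toList.foldl (fun a x => S O (.pair a (.pair x v))) (I O v) := by
  obtain ⟨p₀, n₀, P₀, h₀⟩ := pair hL (pair hI id)
  obtain ⟨p, n, P, hp⟩ : PolyTime fun O w => .pair w.fst.snd (.pair (S O (.pair w.snd.fst
        (.pair w.fst.fst w.snd.snd))) w.snd.snd) :=
    pair (snd (fst id)) (pair (comp hS (pair (fst (snd id)) (pair (fst (fst id))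
      (snd (snd id))))) (snd (snd id)))
  obtain ⟨R, hR⟩ := hb
  let M : Polynomial ℕ := R + .X + P₀ + 2
  refine ⟨.seq p₀ (.seq (.while (.isPair (.fst (.var 0))) p) (.assign 0 (.fst (.snd (.var 0))))),
    max n₀ n, P₀ + (P₀ + 1) * (P.comp M + 3 * M + 3) + 3 * M + R + 1, fun O σ => ?_⟩
  obtain ⟨σ₁, T₁, e₁, r₁, f₁, t₁, s₁⟩ := h₀ O σ
  have hLs : (L O (σ 0)).size ≤ P₀.eval (σ 0).size := by
    simp only [Val.size] at s₁; omega
  obtain ⟨σ₂, T₂, e₂, r₂, s₂, f₂, t₂⟩ := exec_foldLoop (S := S) (n := n) (P := P) (O := O)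
    (fun σ => by
      obtain ⟨σ', T, a, b, c, d, -⟩ := hp O σ
      exact ⟨σ', T, a, b, c, d⟩) (σ 0) (M.eval (σ 0).size) _ _ σ₁ r₁ (fun l hl => by
        have := hR O (σ 0) l hl
        simp only [M, Polynomial.eval_add, Polynomial.eval_X, Polynomial.eval_ofNat]
        omega)
  have hlen := (length_toList_le (L O (σ 0))).trans hLs
  refine ⟨_, _, .seq e₁ (.seq e₂ (.assign _ _ _)), ?_, fun x hx => ?_, ?_, ?_⟩
  · simp [Expr.eval, r₂]
  · rw [Function.update_of_ne (by omega), f₂ x (by omega), f₁ x (by omega)]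
  · have h3 := t₂.trans (Nat.mul_le_mul_right _ (Nat.add_le_add_right hlen 1))
    have := size_snd_le (σ₂ 0)
    simp only [Expr.cost, Expr.eval, Polynomial.eval_add, Polynomial.eval_mul, Polynomial.eval_comp,
      Polynomial.eval_one, Polynomial.eval_ofNat] at h3 ⊢
    omega
  · have := hR O (σ 0) _ (List.prefix_refl _)
    simp only [Polynomial.eval_add]
    omega

/-- A fold takes polynomial time if some measure of the accumulator, comparable to its size, grows only
additively in each step. The measure is needed for steps that may double the size itself. -/
theorem foldl_of_measure {L I S : (Val → Bool) → Val → Val} (hL : PolyTime L) (hI : PolyTime I)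
    (hS : PolyTime S) (μ : Val → ℕ) (hμ : ∀ w, μ w ≤ w.size)
    (R : Polynomial ℕ) (hstep : ∀ O a x v, μ (S O (.pair a (.pair x v))) ≤
      μ a + R.eval (x.size + v.size))
    (hsize : ∀ O a x v, (S O (.pair a (.pair x v))).size ≤ 2 * μ (S O (.pair a (.pair x v))) + 1) :
    PolyTime fun O v => (L O v).toList.foldl (fun a x => S O (.pair a (.pair x v))) (I O v) := by
  obtain ⟨PL, hPL⟩ := hL.exists_size_le
  obtain ⟨PI, hPI⟩ := hI.exists_size_le
  refine foldl hL hI hS ⟨2 * (PI + PL * R.comp (PL + .X)) + 1, fun O v l hl => ?_⟩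
  have key : ∀ l : List Val, (∀ x ∈ l, x.size ≤ PL.eval v.size) →
      μ (l.foldl (fun a x => S O (.pair a (.pair x v))) (I O v)) ≤
        PI.eval v.size + l.length * R.eval (PL.eval v.size + v.size) ∧
      (l.foldl (fun a x => S O (.pair a (.pair x v))) (I O v)).size ≤
        2 * (PI.eval v.size + l.length * R.eval (PL.eval v.size + v.size)) + 1 := by
    intro l
    induction l using List.reverseRecOn with
    | nil =>
      intro _
      have := hμ (I O v)
      have := hPI O v
      simp
      omega
    | append_singleton l x ih =>
      intro h
      have h1 := (ih fun y hy => h y (by simp [hy])).1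
      have h2 := R.eval_nat_mono (Nat.add_le_add_right (h x (by simp)) v.size)
      simp only [List.foldl_append, List.foldl_cons, List.foldl_nil, List.length_append,
        List.length_singleton, add_mul, one_mul]
      have h3 := hstep O (l.foldl (fun a x => S O (.pair a (.pair x v))) (I O v)) x v
      have h4 := hsize O (l.foldl (fun a x => S O (.pair a (.pair x v))) (I O v)) x v
      omega
  have h1 := (key l fun x hx => (size_le_of_mem_toList (hl.subset hx)).trans (hPL O v)).2
  have h2 : l.length ≤ PL.eval v.size :=
    (hl.length_le.trans (length_toList_le _)).trans (hPL O v)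
  have h3 := Nat.mul_le_mul_right (R.eval (PL.eval v.size + v.size)) h2
  simp only [Polynomial.eval_add, Polynomial.eval_mul, Polynomial.eval_comp, Polynomial.eval_X,
    Polynomial.eval_ofNat, Polynomial.eval_one]
  omega

/-- A fold whose accumulator grows only additively in each step. -/
theorem foldl_of_size {L I S : (Val → Bool) → Val → Val} (hL : PolyTime L) (hI : PolyTime I)
    (hS : PolyTime S) (R : Polynomial ℕ) (hstep : ∀ O a x v, (S O (.pair a (.pair x v))).size ≤
      a.size + R.eval (x.size + v.size)) :
    PolyTime fun O v => (L O v).toList.foldl (fun a x => S O (.pair a (.pair x v))) (I O v) :=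
  foldl_of_measure hL hI hS Val.size (fun _ => le_rfl) R hstep (fun _ _ _ _ => by omega)

/-- Pushing the images of the elements of a list onto another list. -/
theorem pushMap {L I : (Val → Bool) → Val → Val} (hL : PolyTime L) (hI : PolyTime I)
    (hF : PolyTime F) : PolyTime fun O v =>
      (L O v).toList.foldl (fun a x => .pair (F O (.pair x v)) a) (I O v) := by
  obtain ⟨P, hP⟩ := hF.exists_size_le
  refine foldl_of_size hL hI (S := fun O w => .pair (F O w.snd) w.fst)
    (pair (comp hF (snd id)) (fst id)) (P.comp (.X + 1) + 1) fun O a x v => ?_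
  have := hP O (.pair x v)
  simp [Val.size, Val.fst, Val.snd] at this ⊢
  omega

theorem foldl_push (f : Val → Val) (l l' : List Val) :
    l.foldl (fun a x => .pair (f x) a) (ofList l') = ofList ((l.map f).reverse ++ l') := by
  induction l generalizing l' with
  | nil => rfl
  | cons x l ih => simpa [ofList] using ih (f x :: l')

theorem reverse (hF : PolyTime F) : PolyTime fun O v => ofList (F O v).toList.reverse := by
  have := pushMap hF (const (ofList [])) (fst id)
  simpa only [Val.fst, foldl_push (fun x => x), List.map_id', List.append_nil] using this

theorem map {L : (Val → Bool) → Val → Val} (hL : PolyTime L) (hF : PolyTime F) :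
    PolyTime fun O v => ofList ((L O v).toList.map fun x => F O (.pair x v)) := by
  have := reverse (pushMap hL (const (ofList [])) hF)
  simpa only [foldl_push (fun x => F _ (.pair x _)), toList_ofList, List.append_nil,
    List.reverse_reverse] using this

theorem append (hF : PolyTime F) (hG : PolyTime G) :
    PolyTime fun O v => ofList ((F O v).toList ++ (G O v).toList) := by
  -- Reversing the second list twice replaces whatever stands at its end by `0`.
  have := pushMap (reverse hF) (reverse (reverse hG)) (fst id)
  simpa only [Val.fst, foldl_push (fun x => x), toList_ofList, List.map_id',
    List.reverse_reverse] using this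

theorem flatten (hF : PolyTime F) :
    PolyTime fun O v => ofList ((F O v).toList.flatMap toList) := by
  have := foldl_of_size hF (const (ofList []))
    (S := fun _ w => ofList (w.fst.toList ++ w.snd.fst.toList))
    (append (fst id) (fst (snd id))) .X fun O a x v => by
      have h1 := size_ofList_toList_le a
      have h2 := size_ofList_toList_le x
      simp only [size_ofList, List.map_append, List.sum_append, Val.fst, Val.snd,
        Polynomial.eval_X] at h1 h2 ⊢
      omega
  have key : ∀ l l' : List Val, l.foldl (fun a x => ofList (a.toList ++ x.toList)) (ofList l') =
      ofList (l' ++ l.flatMap toList) := by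
    intro l
    induction l with
    | nil => simp
    | cons x l ih => intro l'; simp [ih]
  simpa only [Val.fst, Val.snd, key, List.nil_append] using this

theorem flatMap {L : (Val → Bool) → Val → Val} (hL : PolyTime L) (hF : PolyTime F) :
    PolyTime fun O v => ofList ((L O v).toList.flatMap fun x => (F O (.pair x v)).toList) := by
  simpa only [toList_ofList, List.flatMap_map] using flatten (map hL hF)

end PolyTime

/-! ### Arithmetic of fractions and of sparse polynomials -/

namespace Frac

/-- The integer `z` as the fraction `z / 1`. -/
def ofInt (z : ℤ) : Frac := ⟨z, 1, one_pos⟩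

/-- The product of two fractions, not reduced. -/
def mul (a b : Frac) : Frac := ⟨a.num * b.num, a.den * b.den, Nat.mul_pos a.den_pos b.den_pos⟩

/-- The sum of two fractions over the product of the denominators, not reduced. -/
def add (a b : Frac) : Frac :=
  ⟨a.num * b.den + b.num * a.den, a.den * b.den, Nat.mul_pos a.den_pos b.den_pos⟩

theorem den_ne_zero (a : Frac) : (a.den : ℚ) ≠ 0 := by
  exact_mod_cast a.den_pos.ne'

theorem toRat_ofInt (z : ℤ) : (ofInt z).toRat = z := by simp [ofInt, toRat]

theorem toRat_mul (a b : Frac) : (a.mul b).toRat = a.toRat * b.toRat := by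
  simp [mul, toRat, mul_div_mul_comm]

theorem toRat_add (a b : Frac) : (a.add b).toRat = a.toRat + b.toRat := by
  have := a.den_ne_zero
  have := b.den_ne_zero
  simp only [add, toRat]
  push_cast
  field_simp

theorem toRat_eq_zero (a : Frac) : a.toRat = 0 ↔ a.num = 0 := by
  simp [toRat, a.den_ne_zero]

theorem encode_add (a b : Frac) : (a.add b).encode =
    .pair (.num (a.encode.fst.toInt * b.encode.snd.toInt +
      b.encode.fst.toInt * a.encode.snd.toInt))
      (.num (a.encode.snd.toInt * b.encode.snd.toInt)) := by
  simp [Frac.add, Frac.encode, fst_pair, snd_pair, toInt_num]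

end Frac

namespace SparseRep

/-- The encoding of a monomial inside `SparseRep.encode`. -/
def encodeTerm (c : ℕ × Frac) : Val := .pair (.num c.1) c.2.encode

theorem encode_eq (L : SparseRep) : L.encode = ofList (L.map encodeTerm) := rfl

theorem toPoly_nil : toPoly [] = 0 := by simp [toPoly]

theorem toPoly_cons (c : ℕ × Frac) (L : SparseRep) :
    toPoly (c :: L) = Polynomial.monomial c.1 c.2.toRat + L.toPoly := by simp [toPoly]

theorem toPoly_append (L M : SparseRep) : toPoly (L ++ M) = L.toPoly + M.toPoly := by
  simp [toPoly]

/-- The list of all products of monomials; equal exponents are not collected. -/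
def mul (L M : SparseRep) : SparseRep :=
  L.flatMap fun c => M.map fun d => (c.1 + d.1, c.2.mul d.2)

theorem toPoly_mul (L M : SparseRep) : (L.mul M).toPoly = L.toPoly * M.toPoly := by
  induction L with
  | nil => simp [mul, toPoly_nil]
  | cons c L ih =>
    have h : toPoly (M.map fun d => (c.1 + d.1, c.2.mul d.2)) =
        Polynomial.monomial c.1 c.2.toRat * M.toPoly := by
      clear ih
      induction M with
      | nil => simp [toPoly_nil]
      | cons d M ih =>
        simp [toPoly_cons, ih, mul_add, Frac.toRat_mul, Polynomial.monomial_mul_monomial]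
    rw [toPoly_cons, add_mul, ← ih, ← h, ← toPoly_append]
    rfl

/-- The image under the derivation `X * d/dX`. -/
def euler (L : SparseRep) : SparseRep := L.map fun c => (c.1, (Frac.ofInt c.1).mul c.2)

theorem toPoly_euler (L : SparseRep) :
    L.euler.toPoly = Polynomial.X * Polynomial.derivative L.toPoly := by
  induction L with
  | nil => simp [euler, toPoly_nil]
  | cons c L ih =>
    have h : euler (c :: L) = (c.1, (Frac.ofInt c.1).mul c.2) :: euler L := rfl
    rw [h, toPoly_cons, toPoly_cons, ih, Polynomial.derivative_add, mul_add,
      Polynomial.derivative_monomial, Frac.toRat_mul, Frac.toRat_ofInt]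
    congr 1
    rcases c with ⟨_ | n, a⟩
    · simp
    · simp [Polynomial.X_mul_monomial, mul_comm]

/-- The coefficient of `X ^ e`, as an unreduced fraction: equal exponents may occur several times. -/
def coeffFrac (L : SparseRep) (e : ℕ) : Frac :=
  (L.map fun c => if c.1 = e then c.2 else Frac.ofInt 0).foldl Frac.add (Frac.ofInt 0)

theorem coeff_toPoly (L : SparseRep) (e : ℕ) :
    L.toPoly.coeff e = (L.map fun c => if c.1 = e then c.2.toRat else 0).sum := by
  induction L with
  | nil => simp [toPoly_nil]
  | cons c L ih => simp [toPoly_cons, ih, Polynomial.coeff_monomial]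

theorem toRat_coeffFrac (L : SparseRep) (e : ℕ) : (L.coeffFrac e).toRat = L.toPoly.coeff e := by
  have h : ∀ (l : List Frac) (a : Frac),
      (l.foldl Frac.add a).toRat = a.toRat + (l.map Frac.toRat).sum := by
    intro l
    induction l with
    | nil => simp
    | cons b l ih => intro a; simp [ih, Frac.toRat_add, add_assoc]
  rw [coeffFrac, h, coeff_toPoly, List.map_map, Frac.toRat_ofInt, Int.cast_zero, zero_add]
  congr 2
  funext c
  simp only [Function.comp]
  split_ifs <;> simp [Frac.toRat_ofInt]

theorem exists_mem_of_coeff_ne_zero {L : SparseRep} {e : ℕ} (h : L.toPoly.coeff e ≠ 0) :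
    ∃ c ∈ L, c.1 = e := by
  by_contra! hL
  refine h ?_
  rw [coeff_toPoly]
  refine List.sum_eq_zero fun x hx => ?_
  obtain ⟨c, hc, rfl⟩ := List.mem_map.1 hx
  simp [hL c hc]

/-- One step in the search for the leading coefficient. The pair `a` consists of `0` if nothing has
been found yet, and otherwise of the successor of the largest exponent found, and the coefficient. -/
def leadStep (L : SparseRep) (a c : ℕ × Frac) : ℕ × Frac :=
  if (L.coeffFrac c.1).num ≠ 0 then
    if a.1 < c.1 + 1 then (c.1 + 1, L.coeffFrac c.1) else a
  else a

/-- The leading coefficient, also for lists in which monomials repeat or cancel; it is `0 / 1` for the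
zero polynomial. -/
def leadFrac (L : SparseRep) : Frac := (L.foldl L.leadStep (0, Frac.ofInt 0)).2

theorem toRat_leadFrac (L : SparseRep) : L.leadFrac.toRat = L.toPoly.leadingCoeff := by
  have key : ∀ l : List (ℕ × Frac), let a := l.foldl L.leadStep (0, Frac.ofInt 0)
      (∀ c ∈ l, L.toPoly.coeff c.1 ≠ 0 → c.1 < a.1) ∧
      (a = (0, Frac.ofInt 0) ∨
        ∃ e, a = (e + 1, L.coeffFrac e) ∧ L.toPoly.coeff e ≠ 0) := by
    intro l
    induction l using List.reverseRecOn with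
    | nil => simp
    | append_singleton l c ih =>
      simp only [List.foldl_append, List.foldl_cons, List.foldl_nil, List.mem_append,
        List.mem_singleton] at ih ⊢
      obtain ⟨h1, h2⟩ := ih
      generalize l.foldl L.leadStep (0, Frac.ofInt 0) = a at h1 h2
      have hc : (L.coeffFrac c.1).num ≠ 0 ↔ L.toPoly.coeff c.1 ≠ 0 := by
        rw [← toRat_coeffFrac, Ne, Ne, Frac.toRat_eq_zero]
      rw [leadStep]
      split_ifs with h3 h4
      · refine ⟨?_, Or.inr ⟨_, rfl, hc.1 h3⟩⟩
        rintro d (hd | rfl) hd'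
        · exact (h1 d hd hd').trans h4
        · exact Nat.lt_succ_self _
      · refine ⟨?_, h2⟩
        rintro d (hd | rfl) hd'
        · exact h1 d hd hd'
        · omega
      · refine ⟨?_, h2⟩
        rintro d (hd | rfl) hd'
        · exact h1 d hd hd'
        · exact absurd (hc.2 hd') h3
  obtain ⟨h1, h2⟩ := key L
  by_cases hp : L.toPoly = 0
  · rcases h2 with h2 | ⟨e, -, h2⟩
    · simp [leadFrac, h2, hp, Frac.toRat_ofInt]
    · simp [hp] at h2
  · have hn : L.toPoly.coeff L.toPoly.natDegree ≠ 0 := by simpa using hp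
    obtain ⟨c, hc, hce⟩ := exists_mem_of_coeff_ne_zero hn
    have h3 := h1 c hc (by rwa [hce])
    rcases h2 with h2 | ⟨e, h2, he⟩
    · simp [h2] at h3
    · have h4 := Polynomial.le_natDegree_of_ne_zero he
      rw [h2, hce] at h3
      have h5 : e = L.toPoly.natDegree := by simp only at h3; omega
      rw [leadFrac, h2, toRat_coeffFrac, h5, Polynomial.leadingCoeff]

end SparseRep

/-! ### Computing with sparse polynomials in polynomial time -/

namespace PolyTime

variable {F G : (Val → Bool) → Val → Val}

/-- The product of encoded fractions. -/
theorem fracMul (hF : PolyTime F) (hG : PolyTime G) : PolyTime fun O v =>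
    .pair (.num ((F O v).fst.toInt * (G O v).fst.toInt))
      (.num ((F O v).snd.toInt * (G O v).snd.toInt)) :=
  pair (mul (fst hF) (fst hG)) (mul (snd hF) (snd hG))

/-- The sum of the fractions `b₁, …, bₙ` in a list. Numerators and denominators stay of polynomial
size because the maximum of the two lengths grows by at most the length of `bᵢ`, plus one. -/
theorem fracSum (hF : PolyTime F) : PolyTime fun O v =>
    (F O v).toList.foldl (fun a x => .pair
      (.num (a.fst.toInt * x.snd.toInt + x.fst.toInt * a.snd.toInt))
      (.num (a.snd.toInt * x.snd.toInt))) (Frac.ofInt 0).encode := by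
  have hS : PolyTime fun _ w => .pair
      (.num (w.fst.fst.toInt * w.snd.fst.snd.toInt + w.snd.fst.fst.toInt * w.fst.snd.toInt))
      (.num (w.fst.snd.toInt * w.snd.fst.snd.toInt)) :=
    pair (add (mul (fst (fst id)) (snd (fst (snd id))))
      (mul (fst (fst (snd id))) (snd (fst id)))) (mul (snd (fst id)) (snd (fst (snd id))))
  refine foldl_of_measure hF (const _) hS
    (fun w => max w.fst.toInt.natAbs.size w.snd.toInt.natAbs.size + 1) (fun w => ?_) (.X + 1)
    (fun O a x v => ?_) (fun O a x v => ?_)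
  · have := size_toInt_le w.fst
    have := size_toInt_le w.snd
    have := size_fst_le w
    have := size_snd_le w
    omega
  · have h1 := Nat.size_le_size (Int.natAbs_add_le (a.fst.toInt * x.snd.toInt)
      (x.fst.toInt * a.snd.toInt))
    have h2 := Nat.size_add_le (a.fst.toInt * x.snd.toInt).natAbs
      (x.fst.toInt * a.snd.toInt).natAbs
    have h3 := Nat.size_mul_le a.fst.toInt.natAbs x.snd.toInt.natAbs
    have h4 := Nat.size_mul_le x.fst.toInt.natAbs a.snd.toInt.natAbs
    have h5 := Nat.size_mul_le a.snd.toInt.natAbs x.snd.toInt.natAbs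
    have h6 := size_toInt_le x.fst
    have h7 := size_toInt_le x.snd
    have h8 := size_fst_le x
    have h9 := size_snd_le x
    simp only [Int.natAbs_mul, fst_pair, snd_pair, toInt_num, Polynomial.eval_add, Polynomial.eval_X,
      Polynomial.eval_one] at h1 h2 ⊢
    omega
  · simp only [fst_pair, snd_pair, toInt_num, Val.size]
    omega

/-- The function that takes the encodings of an exponent `e` (as the first component of a pair) and
of a sparse polynomial to the coefficient of `X ^ e`. -/
theorem exists_coeffFrac : ∃ K, PolyTime K ∧ ∀ O (c : ℕ × Frac) (L : SparseRep),
    K O (.pair (SparseRep.encodeTerm c) L.encode) = (L.coeffFrac c.1).encode := by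
  refine ⟨_, fracSum (map (snd id) (F := fun _ w =>
    if (Val.num (w.fst.fst.toInt - w.snd.fst.fst.toInt)).truthy then (Frac.ofInt 0).encode
      else w.fst.snd) (ite (sub (fst (fst id)) (fst (fst (snd id)))) (const _) (snd (fst id)))),
    fun O c L => ?_⟩
  rw [SparseRep.coeffFrac, ← List.foldl_hom Frac.encode (g₂ := fun a b =>
    .pair (.num (a.fst.toInt * b.encode.snd.toInt + b.encode.fst.toInt * a.snd.toInt))
      (.num (a.snd.toInt * b.encode.snd.toInt))) (H := fun a b => (Frac.encode_add a b).symm)]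
  rw [SparseRep.encode_eq]
  simp only [toList_ofList, snd_pair, List.foldl_map, fst_pair, SparseRep.encodeTerm, toInt_num,
    truthy, sub_ne_zero, decide_eq_true_eq]
  congr 1
  funext a d
  by_cases h : d.1 = c.1
  · simp [h]
  · simp [h]

theorem exists_leadFrac : ∃ K, PolyTime K ∧ ∀ O (L : SparseRep),
    K O L.encode = L.leadFrac.encode := by
  obtain ⟨K, hK, hKe⟩ := exists_coeffFrac
  -- The step on `(a, (c, L))`, and the value that it stores when it changes `a`.
  have hN : PolyTime fun O w => .pair (.num (w.fst.fst.toInt + (Val.num 1).toInt)) (K O w) :=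
    pair (add (fst (fst id)) (num 1)) hK
  have hS : PolyTime fun O w =>
      if (K O w.snd).fst.truthy then
        if (ofBool (decide (0 < (Val.num ((Val.num (w.snd.fst.fst.toInt +
          (Val.num 1).toInt)).toInt - w.fst.fst.toInt)).toInt))).truthy then
          .pair (.num (w.snd.fst.fst.toInt + (Val.num 1).toInt)) (K O w.snd) else w.fst
      else w.fst :=
    ite (fst (comp hK (snd id))) (ite (pos (sub (add (fst (fst (snd id))) (num 1))
      (fst (fst id)))) (comp hN (snd id)) (fst id)) (fst id)
  obtain ⟨P, hP⟩ := hN.exists_size_le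
  refine ⟨_, snd (foldl_of_size id (const (SparseRep.encodeTerm (0, Frac.ofInt 0))) hS
    (P.comp (.X + 1)) fun O a x v => ?_), fun O L => ?_⟩
  · have key : ∀ (b b' : Bool) (y : Val),
        (if b then if b' then y else a else a).size ≤ a.size + y.size := by
      intro b b' y
      cases b <;> cases b' <;> simp
    refine (key _ _ _).trans (Nat.add_le_add_left ((hP O (.pair x v)).trans ?_) _)
    simp [Val.size]
  · have h : ∀ a c : ℕ × Frac, (if (K O (.pair (SparseRep.encodeTerm c) L.encode)).fst.truthy then
        if (ofBool (decide (0 < (Val.num ((Val.num ((SparseRep.encodeTerm c).fst.toInt +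
          (Val.num 1).toInt)).toInt - (SparseRep.encodeTerm a).fst.toInt)).toInt))).truthy then
          .pair (.num ((SparseRep.encodeTerm c).fst.toInt + (Val.num 1).toInt))
            (K O (.pair (SparseRep.encodeTerm c) L.encode)) else SparseRep.encodeTerm a
      else SparseRep.encodeTerm a) = SparseRep.encodeTerm (L.leadStep a c) := by
      intro a c
      have h1 : ((L.coeffFrac c.1).encode.fst.truthy = true) ↔ (L.coeffFrac c.1).num ≠ 0 := by
        simp [Frac.encode, truthy]
      have h2 : (0 : ℤ) < c.1 + 1 - a.1 ↔ a.1 < c.1 + 1 := by omega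
      rw [hKe]
      simp only [SparseRep.encodeTerm, fst_pair, toInt_num, truthy_ofBool, decide_eq_true_eq,
        SparseRep.leadStep, h1, h2]
      split_ifs <;> simp
    rw [SparseRep.leadFrac]
    simp only [snd_pair, fst_pair]
    have h3 : L.encode.toList = L.map SparseRep.encodeTerm := by simp [SparseRep.encode_eq]
    rw [h3, List.foldl_map]
    exact congrArg Val.snd (List.foldl_hom (l := L) SparseRep.encodeTerm (g₁ := L.leadStep)
      (init := ((0 : ℕ), Frac.ofInt 0)) h)

end PolyTime

/-- `g` can be computed in polynomial time from the encoding `enc` of its argument, with an oracle. -/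
def PolyTimeOn {I : Type*} (enc : I → Val) (g : (Val → Bool) → I → Val) : Prop :=
  ∃ F, PolyTime F ∧ ∀ O i, F O (enc i) = g O i

namespace PolyTimeOn

variable {I : Type*} {enc : I → Val} {g h c : (Val → Bool) → I → Val}

theorem const (v : Val) : PolyTimeOn enc fun _ _ => v :=
  ⟨_, PolyTime.const v, fun _ _ => rfl⟩

theorem comp {G : (Val → Bool) → Val → Val} (hG : PolyTime G) (hg : PolyTimeOn enc g) :
    PolyTimeOn enc fun O i => G O (g O i) := by
  obtain ⟨F, hF, hFe⟩ := hg
  exact ⟨_, hG.comp hF, fun O i => by rw [hFe]⟩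

theorem pair (hg : PolyTimeOn enc g) (hh : PolyTimeOn enc h) :
    PolyTimeOn enc fun O i => (g O i).pair (h O i) := by
  obtain ⟨F, hF, hFe⟩ := hg
  obtain ⟨G, hG, hGe⟩ := hh
  exact ⟨_, hF.pair hG, fun O i => by rw [hFe, hGe]⟩

theorem ite (hc : PolyTimeOn enc c) (hg : PolyTimeOn enc g) (hh : PolyTimeOn enc h) :
    PolyTimeOn enc fun O i => if (c O i).truthy then g O i else h O i := by
  obtain ⟨E, hE, hEe⟩ := hc
  obtain ⟨F, hF, hFe⟩ := hg
  obtain ⟨G, hG, hGe⟩ := hh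
  exact ⟨_, hE.ite hF hG, fun O i => by rw [hFe, hGe, hEe]⟩

theorem query (hg : PolyTimeOn enc g) : PolyTimeOn enc fun O i => .ofBool (O (g O i)) :=
  comp (PolyTime.query PolyTime.id) hg

theorem ofList_ofFn {n : ℕ} {g : Fin n → (Val → Bool) → I → Val}
    (hg : ∀ j, PolyTimeOn enc (g j)) :
    PolyTimeOn enc fun O i => ofList (List.ofFn fun j => g j O i) := by
  induction n with
  | zero => simpa using const (ofList [])
  | succ n ih => simpa [List.ofFn_succ, ofList] using pair (hg 0) (ih fun j => hg j.succ)

/-- Entries of a list of fixed length can be read off. -/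
theorem of_ofList_ofFn {n : ℕ} {g : Fin n → (Val → Bool) → I → Val}
    (hg : PolyTimeOn enc fun O i => ofList (List.ofFn fun j => g j O i)) (j : Fin n) :
    PolyTimeOn enc (g j) := by
  induction n with
  | zero => exact j.elim0
  | succ n ih =>
    simp only [List.ofFn_succ, ofList] at hg
    induction j using Fin.cases with
    | zero => exact comp (PolyTime.fst PolyTime.id) hg
    | succ j => exact ih (g := fun j => g j.succ) (comp (PolyTime.snd PolyTime.id) hg) j

theorem and {b b' : (Val → Bool) → I → Bool} (hb : PolyTimeOn enc fun O i => .ofBool (b O i))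
    (hb' : PolyTimeOn enc fun O i => .ofBool (b' O i)) :
    PolyTimeOn enc fun O i => .ofBool (b O i && b' O i) := by
  convert ite hb hb' (const (.ofBool false)) using 3 with O i
  cases h : b O i <;> simp

theorem not {b : (Val → Bool) → I → Bool} (hb : PolyTimeOn enc fun O i => .ofBool (b O i)) :
    PolyTimeOn enc fun O i => .ofBool (!b O i) := by
  convert ite hb (const (.ofBool false)) (const (.ofBool true)) using 3 with O i
  cases h : b O i <;> simp

theorem forall_fintype {ι : Type*} [Fintype ι] {b : ι → (Val → Bool) → I → Bool}
    (hb : ∀ a, PolyTimeOn enc fun O i => .ofBool (b a O i)) :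
    PolyTimeOn enc fun O i => .ofBool (decide (∀ a, b a O i = true)) := by
  classical
  suffices h : ∀ s : Finset ι,
      PolyTimeOn enc fun O i => .ofBool (decide (∀ a ∈ s, b a O i = true)) by
    simpa using h Finset.univ
  intro s
  induction s using Finset.induction_on with
  | empty => simpa using const (.ofBool true)
  | insert a s _ ih => simpa using and (hb a) ih

end PolyTimeOn

/-- A sparse representation of the rational polynomial `p i` can be computed in polynomial time. -/
def SparsePolyTime {I : Type*} (enc : I → Val) (p : I → Polynomial ℚ) : Prop :=
  ∃ L : I → SparseRep, PolyTimeOn enc (fun _ i => (L i).encode) ∧ ∀ i, (L i).toPoly = p i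

namespace SparsePolyTime

variable {I : Type*} {enc : I → Val} {p q : I → Polynomial ℚ}

theorem C_intCast {z : I → ℤ} (hz : PolyTimeOn enc fun _ i => .num (z i)) :
    SparsePolyTime enc fun i => Polynomial.C (z i : ℚ) := by
  refine ⟨fun i => [(0, Frac.ofInt (z i))], ?_, fun i => by
    simp [SparseRep.toPoly, Frac.toRat_ofInt]⟩
  exact .pair (.pair (.const (.num 0)) (.pair hz (.const (.num 1)))) (.const (.num 0))

theorem intCast (z : ℤ) : SparsePolyTime enc fun _ => (z : Polynomial ℚ) := by
  simpa using C_intCast (enc := enc) (z := fun _ => z) (.const _)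

theorem add (hp : SparsePolyTime enc p) (hq : SparsePolyTime enc q) :
    SparsePolyTime enc fun i => p i + q i := by
  obtain ⟨L, ⟨F, hF, hFe⟩, hL⟩ := hp
  obtain ⟨M, ⟨G, hG, hGe⟩, hM⟩ := hq
  refine ⟨fun i => L i ++ M i, ⟨_, hF.append hG, fun O i => ?_⟩, fun i => by
    rw [SparseRep.toPoly_append, hL, hM]⟩
  simp [hFe, hGe, SparseRep.encode_eq]

theorem mul (hp : SparsePolyTime enc p) (hq : SparsePolyTime enc q) :
    SparsePolyTime enc fun i => p i * q i := by
  obtain ⟨L, ⟨F, hF, hFe⟩, hL⟩ := hp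
  obtain ⟨M, ⟨G, hG, hGe⟩, hM⟩ := hq
  have hT : PolyTime fun _ w => .pair (.num (w.snd.fst.fst.toInt + w.fst.fst.toInt))
      (.pair (.num (w.snd.fst.snd.fst.toInt * w.fst.snd.fst.toInt))
        (.num (w.snd.fst.snd.snd.toInt * w.fst.snd.snd.toInt))) :=
    .pair (.add (.fst (.fst (.snd .id))) (.fst (.fst .id)))
      (.fracMul (.snd (.fst (.snd .id))) (.snd (.fst .id)))
  refine ⟨fun i => (L i).mul (M i), ⟨_, hF.flatMap ((hG.comp (.snd .id)).map hT),
    fun O i => ?_⟩, fun i => by rw [SparseRep.toPoly_mul, hL, hM]⟩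
  simp [hFe, hGe, SparseRep.encode_eq, SparseRep.mul, List.map_flatMap, List.flatMap_map,
    SparseRep.encodeTerm, Frac.encode, Frac.mul, fst_pair, snd_pair, toInt_num, Function.comp_def]

theorem euler (hp : SparsePolyTime enc p) :
    SparsePolyTime enc fun i => Polynomial.X * Polynomial.derivative (p i) := by
  obtain ⟨L, ⟨F, hF, hFe⟩, hL⟩ := hp
  have hT : PolyTime fun _ w => .pair w.fst.fst
      (.pair (.num (w.fst.fst.toInt * w.fst.snd.fst.toInt)) w.fst.snd.snd) :=
    .pair (.fst (.fst .id)) (.pair (.mul (.fst (.fst .id)) (.fst (.snd (.fst .id))))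
      (.snd (.snd (.fst .id))))
  refine ⟨fun i => (L i).euler, ⟨_, hF.map hT, fun O i => ?_⟩, fun i => by
    rw [SparseRep.toPoly_euler, hL]⟩
  simp [hFe, SparseRep.encode_eq, SparseRep.euler, SparseRep.encodeTerm, Frac.encode, Frac.mul,
    Frac.ofInt, fst_pair, snd_pair, toInt_num, Function.comp_def]

theorem sum {ι : Type*} (s : Finset ι) {p : ι → I → Polynomial ℚ}
    (hp : ∀ a, SparsePolyTime enc (p a)) : SparsePolyTime enc fun i => ∑ a ∈ s, p a i := by
  classical
  induction s using Finset.induction_on with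
  | empty => simpa using intCast 0
  | insert a s ha ih => simpa [Finset.sum_insert ha] using add (hp a) ih

theorem prod {ι : Type*} (s : Finset ι) {p : ι → I → Polynomial ℚ}
    (hp : ∀ a, SparsePolyTime enc (p a)) : SparsePolyTime enc fun i => ∏ a ∈ s, p a i := by
  classical
  induction s using Finset.induction_on with
  | empty => simpa using intCast 1
  | insert a s ha ih => simpa [Finset.prod_insert ha] using mul (hp a) ih

/-- Determinants of a fixed size, by expansion over all permutations. -/
theorem det {n : ℕ} {A : I → Matrix (Fin n) (Fin n) (Polynomial ℚ)}
    (hA : ∀ a b, SparsePolyTime enc fun i => A i a b) : SparsePolyTime enc fun i => (A i).det := by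
  simp only [Matrix.det_apply']
  exact sum _ fun s => mul (intCast _) (prod _ fun a => hA (s a) a)

theorem exists_leadFrac (hp : SparsePolyTime enc p) : ∃ q : I → Frac,
    PolyTimeOn enc (fun _ i => (q i).encode) ∧ ∀ i, (q i).toRat = (p i).leadingCoeff := by
  obtain ⟨L, hL, hLp⟩ := hp
  obtain ⟨K, hK, hKe⟩ := PolyTime.exists_leadFrac
  refine ⟨fun i => (L i).leadFrac, ?_, fun i => by rw [SparseRep.toRat_leadFrac, hLp]⟩
  simpa only [hKe] using PolyTimeOn.comp hK hL

theorem eq_zero (hp : SparsePolyTime enc p) :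
    PolyTimeOn enc fun _ i => .ofBool (decide (p i = 0)) := by
  obtain ⟨q, hq, hqp⟩ := exists_leadFrac hp
  convert PolyTimeOn.ite (PolyTimeOn.comp (PolyTime.fst PolyTime.id) hq)
    (.const (.ofBool false)) (.const (.ofBool true)) using 3 with O i
  have h : p i = 0 ↔ (q i).num = 0 := by
    rw [← Polynomial.leadingCoeff_eq_zero, ← hqp, Frac.toRat_eq_zero]
  by_cases h0 : (q i).num = 0 <;> simp [h, h0, Frac.encode, truthy]

end SparsePolyTime

/-! ### Wronskians with respect to the derivation `X * d/dX` -/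

/-- The derivation `X * d/dX` of `ℚ[X]`, which keeps exponents and needs no subtraction on them. -/
noncomputable def eulerOp (p : Polynomial ℚ) : Polynomial ℚ :=
  Polynomial.X * Polynomial.derivative p

theorem eulerOp_add (p q : Polynomial ℚ) : eulerOp (p + q) = eulerOp p + eulerOp q := by
  simp [eulerOp, mul_add]

theorem eulerOp_zero : eulerOp 0 = 0 := by simp [eulerOp]

theorem eulerOp_mul (p q : Polynomial ℚ) :
    eulerOp (p * q) = eulerOp p * q + p * eulerOp q := by
  simp only [eulerOp, Polynomial.derivative_mul]; ring

theorem eulerOp_C_mul (c : ℚ) (p : Polynomial ℚ) :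
    eulerOp (Polynomial.C c * p) = Polynomial.C c * eulerOp p := by
  simp only [eulerOp, Polynomial.derivative_C_mul]; ring

theorem eulerOp_sum {ι : Type*} (s : Finset ι) (p : ι → Polynomial ℚ) :
    eulerOp (∑ a ∈ s, p a) = ∑ a ∈ s, eulerOp (p a) := by
  simp [eulerOp, Finset.mul_sum]

theorem coeff_eulerOp (p : Polynomial ℚ) (n : ℕ) : (eulerOp p).coeff n = n * p.coeff n := by
  cases n with
  | zero => simp [eulerOp]
  | succ n => simp [eulerOp, Polynomial.coeff_X_mul, Polynomial.coeff_derivative, mul_comm]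

theorem natDegree_eulerOp_le (p : Polynomial ℚ) : (eulerOp p).natDegree ≤ p.natDegree := by
  refine Polynomial.natDegree_le_iff_coeff_eq_zero.2 fun n hn => ?_
  rw [coeff_eulerOp, Polynomial.coeff_eq_zero_of_natDegree_lt hn, mul_zero]

theorem mul_eulerOp_pow (p : Polynomial ℚ) (n : ℕ) :
    p * eulerOp (p ^ n) = n * eulerOp p * p ^ n := by
  induction n with
  | zero => simp [eulerOp]
  | succ n ih =>
    rw [pow_succ, eulerOp_mul, mul_add, ← mul_assoc, ih]
    push_cast
    ring

/-- Comparison of the top coefficients: `θ` multiplies the leading coefficient by the degree. -/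
theorem natDegree_eq_of_mul_eulerOp_eq {V N : Polynomial ℚ} (hV : V ≠ 0) (hN : N ≠ 0)
    (h : V * eulerOp N = N * eulerOp V) : N.natDegree = V.natDegree := by
  have h1 : (V * eulerOp N).coeff (V.natDegree + N.natDegree) =
      V.leadingCoeff * (N.natDegree * N.leadingCoeff) := by
    rw [Polynomial.coeff_mul_add_eq_of_natDegree_le le_rfl (natDegree_eulerOp_le N), coeff_eulerOp]
    rfl
  have h2 : (N * eulerOp V).coeff (V.natDegree + N.natDegree) =
      N.leadingCoeff * (V.natDegree * V.leadingCoeff) := by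
    rw [add_comm, Polynomial.coeff_mul_add_eq_of_natDegree_le le_rfl (natDegree_eulerOp_le V),
      coeff_eulerOp]
    rfl
  rw [h, h2] at h1
  have h3 : N.leadingCoeff * V.leadingCoeff ≠ 0 := by simp [hV, hN]
  have h4 : (V.natDegree : ℚ) = N.natDegree := mul_left_cancel₀ h3 (by linear_combination h1)
  exact_mod_cast h4.symm

/-- The constants of the derivation on quotients: if `N / V` has derivative zero, it is constant. -/
theorem exists_eq_C_mul_of_mul_eulerOp_eq {V N : Polynomial ℚ} (hV : V ≠ 0)
    (h : V * eulerOp N = N * eulerOp V) : ∃ c : ℚ, N = Polynomial.C c * V := by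
  -- With this `c`, the difference satisfies the same equation, but its coefficient in the only
  -- possible degree vanishes.
  let c := N.coeff V.natDegree / V.leadingCoeff
  refine ⟨c, ?_⟩
  by_contra hne
  have h0 : N + Polynomial.C (-c) * V ≠ 0 := by
    intro h0
    refine hne ?_
    rw [Polynomial.C_neg] at h0
    linear_combination h0
  have h1 := natDegree_eq_of_mul_eulerOp_eq hV h0 (by
    rw [eulerOp_add, eulerOp_C_mul]; linear_combination h)
  have h2 : (N + Polynomial.C (-c) * V).leadingCoeff = 0 := by
    rw [Polynomial.leadingCoeff, h1, Polynomial.coeff_add, Polynomial.coeff_C_mul]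
    have hV' : V.leadingCoeff ≠ 0 := by simpa using hV
    simp only [c, Polynomial.leadingCoeff] at hV' ⊢
    field_simp
    ring
  exact h0 (Polynomial.leadingCoeff_eq_zero.1 h2)

/-- The Wronskian matrix of a family of polynomials, for the derivation `X * d/dX`. -/
noncomputable def wronskianMatrix {r : ℕ} (y : Fin r → Polynomial ℚ) :
    Matrix (Fin r) (Fin r) (Polynomial ℚ) :=
  Matrix.of fun a l => eulerOp^[l] (y a)

/-- If the Wronskian of `y` does not vanish, but vanishes after `z` is added to the family, then `z` is
a linear combination of `y` with constant coefficients. -/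
theorem exists_eq_sum_of_wronskian {r : ℕ} {y : Fin r → Polynomial ℚ} {z : Polynomial ℚ}
    (hy : (wronskianMatrix y).det ≠ 0)
    (hz : (wronskianMatrix (Fin.snoc y z : Fin (r + 1) → Polynomial ℚ)).det = 0) :
    ∃ c : Fin r → ℚ, z = ∑ a, Polynomial.C (c a) * y a := by
  have hker : ∀ u : Fin r → Polynomial ℚ,
      (∀ l < r, ∑ a, u a * eulerOp^[l] (y a) = 0) → u = 0 := by
    intro u hu
    by_contra hne
    exact hy (Matrix.exists_vecMul_eq_zero_iff.1 ⟨u, hne, by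
      ext1 l
      simpa [Matrix.vecMul, dotProduct, wronskianMatrix] using hu l l.2⟩)
  obtain ⟨v, hv0, hv⟩ := Matrix.exists_vecMul_eq_zero_iff.2 hz
  let u : Fin r → Polynomial ℚ := fun a => v a.castSucc
  let V := v (Fin.last r)
  have hrel : ∀ l < r + 1, ∑ a, u a * eulerOp^[l] (y a) + V * eulerOp^[l] z = 0 := by
    intro l hl
    have := congrFun hv ⟨l, hl⟩
    simpa [Matrix.vecMul, dotProduct, wronskianMatrix, Fin.sum_univ_castSucc] using this
  have hV : V ≠ 0 := by
    intro hV
    refine hv0 ?_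
    have hu : u = 0 := hker u fun l hl => by
      have := hrel l (by omega)
      rwa [hV, zero_mul, add_zero] at this
    funext a
    induction a using Fin.lastCases with
    | last => exact hV
    | cast a => exact congrFun hu a
  -- Differentiating a relation and subtracting the next one differentiates its coefficients.
  have hder : ∀ l < r, ∑ a, eulerOp (u a) * eulerOp^[l] (y a) + eulerOp V * eulerOp^[l] z = 0 := by
    intro l hl
    have h1 := congrArg eulerOp (hrel l (by omega))
    have h2 := hrel (l + 1) (by omega)
    simp only [eulerOp_add, eulerOp_sum, eulerOp_mul, eulerOp_zero, Finset.sum_add_distrib] at h1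
    simp only [Function.iterate_succ_apply'] at h2
    linear_combination h1 - h2
  have hconst : (fun a => V * eulerOp (u a) - u a * eulerOp V) = 0 := hker _ fun l hl => by
    have h1 := hrel l (by omega)
    have h2 := hder l hl
    simp only [sub_mul, Finset.sum_sub_distrib, mul_assoc, mul_left_comm _ (eulerOp V),
      ← Finset.mul_sum]
    linear_combination V * h2 - eulerOp V * h1
  choose c hc using fun a => exists_eq_C_mul_of_mul_eulerOp_eq (N := u a) hV
    (sub_eq_zero.1 (congrFun hconst a))
  refine ⟨fun a => -c a, mul_left_cancel₀ hV ?_⟩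
  have h1 := hrel 0 (by omega)
  simp only [hc, Function.iterate_zero, id] at h1
  have h2 : ∀ a, Polynomial.C (c a) * V * y a = V * (Polynomial.C (c a) * y a) := fun a => by ring
  simp only [h2, ← Finset.mul_sum] at h1
  simp only [Polynomial.C_neg, neg_mul, Finset.sum_neg_distrib]
  linear_combination h1

theorem iterate_eulerOp_sum_C_mul {r : ℕ} (c : Fin r → ℚ) (y : Fin r → Polynomial ℚ) (l : ℕ) :
    eulerOp^[l] (∑ a, Polynomial.C (c a) * y a) = ∑ a, Polynomial.C (c a) * eulerOp^[l] (y a) := by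
  induction l with
  | zero => rfl
  | succ l ih => simp only [Function.iterate_succ_apply', ih, eulerOp_sum, eulerOp_C_mul]

/-- Cramer's rule for the coefficients of a linear combination. -/
theorem wronskian_update {r : ℕ} (y : Fin r → Polynomial ℚ) (c : Fin r → ℚ) (a : Fin r) :
    (wronskianMatrix (Function.update y a (∑ b, Polynomial.C (c b) * y b))).det =
      Polynomial.C (c a) * (wronskianMatrix y).det := by
  have h : wronskianMatrix (Function.update y a (∑ b, Polynomial.C (c b) * y b)) =
      (wronskianMatrix y).updateRow a (∑ b, Polynomial.C (c b) • wronskianMatrix y b) := by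
    ext1 b l
    by_cases hb : b = a
    · subst hb
      simp [wronskianMatrix, iterate_eulerOp_sum_C_mul]
    · simp [wronskianMatrix, hb]
  rw [h, Matrix.det_updateRow_sum, smul_eq_mul]

theorem eq_zero_of_sum_C_mul_eq_zero {r : ℕ} {y : Fin r → Polynomial ℚ}
    (hy : (wronskianMatrix y).det ≠ 0) {c : Fin r → ℚ} (h : ∑ a, Polynomial.C (c a) * y a = 0)
    (a : Fin r) : c a = 0 := by
  have h1 := wronskian_update y c a
  rw [h, Matrix.det_eq_zero_of_row_eq_zero a fun l => by
    have : ∀ l : ℕ, eulerOp^[l] 0 = 0 := fun l => by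
      induction l with
      | zero => rfl
      | succ l ih => rw [Function.iterate_succ_apply', ih, eulerOp_zero]
    simp [wronskianMatrix, this]] at h1
  simpa [hy] using h1.symm

/-! ### Wronskians of products of powers -/

section Powers

variable {k m : ℕ} (f : Fin m → Polynomial ℚ) (α : Fin k → Fin m → ℕ)

/-- The product `∏ j, f j` times the logarithmic derivative of `∏ j, f j ^ α i j`. -/
noncomputable def logDerivNum (i : Fin k) : Polynomial ℚ :=
  ∑ j, Polynomial.C ((α i j : ℤ) : ℚ) * eulerOp (f j) * ∏ j' ∈ Finset.univ.erase j, f j'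

/-- The sparse factor of the `l`-th derivative of `g = ∏ j, f j ^ α i j`: that derivative is
`g * derivFactor f α i l / (∏ j, f j) ^ l`. -/
noncomputable def derivFactor (i : Fin k) : ℕ → Polynomial ℚ
  | 0 => 1
  | l + 1 => (logDerivNum f α i + Polynomial.C ((-l : ℤ) : ℚ) * eulerOp (∏ j, f j)) *
      derivFactor i l + (∏ j, f j) * eulerOp (derivFactor i l)

theorem prod_mul_eulerOp_prod_pow (i : Fin k) :
    (∏ j, f j) * eulerOp (∏ j, f j ^ α i j) = logDerivNum f α i * ∏ j, f j ^ α i j := by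
  have key : ∀ s : Finset (Fin m), (∏ j ∈ s, f j) * eulerOp (∏ j ∈ s, f j ^ α i j) =
      (∑ j ∈ s, Polynomial.C ((α i j : ℤ) : ℚ) * eulerOp (f j) * ∏ j' ∈ s.erase j, f j') *
        ∏ j ∈ s, f j ^ α i j := by
    intro s
    induction s using Finset.induction_on with
    | empty => simp [eulerOp]
    | insert a s ha ih =>
      have h1 : ∀ j ∈ s, ∏ j' ∈ (insert a s).erase j, f j' = f a * ∏ j' ∈ s.erase j, f j' := by
        intro j hj
        have : a ≠ j := fun h => ha (h ▸ hj)
        rw [Finset.erase_insert_of_ne this, Finset.prod_insert (by simp [ha])]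
      rw [Finset.prod_insert ha, Finset.prod_insert ha, Finset.sum_insert ha,
        Finset.erase_insert ha, Finset.sum_congr rfl fun j hj => by rw [h1 j hj], eulerOp_mul]
      have h2 : ∑ j ∈ s, Polynomial.C ((α i j : ℤ) : ℚ) * eulerOp (f j) *
          (f a * ∏ j' ∈ s.erase j, f j') = f a * ∑ j ∈ s, Polynomial.C ((α i j : ℤ) : ℚ) *
          eulerOp (f j) * ∏ j' ∈ s.erase j, f j' := by
        rw [Finset.mul_sum]
        exact Finset.sum_congr rfl fun j _ => by ring
      have h3 := mul_eulerOp_pow (f a) (α i a)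
      have h4 : Polynomial.C ((α i a : ℤ) : ℚ) = (α i a : Polynomial ℚ) := by simp
      rw [h2, h4]
      linear_combination (∏ j ∈ s, f j) * (∏ j ∈ s, f j ^ α i j) * h3 + f a * f a ^ α i a * ih
  exact key Finset.univ

theorem prod_pow_mul_iterate_eulerOp (i : Fin k) (l : ℕ) :
    (∏ j, f j) ^ l * eulerOp^[l] (∏ j, f j ^ α i j) =
      (∏ j, f j ^ α i j) * derivFactor f α i l := by
  induction l with
  | zero => simp [derivFactor]
  | succ l ih =>
    have h1 := congrArg (fun p => (∏ j, f j) * eulerOp p) ih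
    have h2 := prod_mul_eulerOp_prod_pow f α i
    have h3 := mul_eulerOp_pow (∏ j, f j) l
    have h4 : Polynomial.C ((-l : ℤ) : ℚ) = -(l : Polynomial ℚ) := by simp
    simp only [eulerOp_mul] at h1
    rw [Function.iterate_succ_apply', derivFactor, h4]
    linear_combination h1 + derivFactor f α i l * h2 - eulerOp^[l] (∏ j, f j ^ α i j) * h3
      - l * eulerOp (∏ j, f j) * ih

/-- The sparse factor of the Wronskian of a subfamily `∏ j, f j ^ α (s a) j`. -/
noncomputable def sparseWronskian {r : ℕ} (s : Fin r → Fin k) : Polynomial ℚ :=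
  (Matrix.of fun a l : Fin r => derivFactor f α (s a) l).det

theorem wronskian_prod_pow {r : ℕ} (s : Fin r → Fin k) :
    (∏ l : Fin r, (∏ j, f j) ^ (l : ℕ)) *
        (wronskianMatrix fun a => ∏ j, f j ^ α (s a) j).det =
      (∏ a, ∏ j, f j ^ α (s a) j) * sparseWronskian f α s := by
  rw [sparseWronskian, ← Matrix.det_mul_row, ← Matrix.det_mul_column]
  congr 1
  ext1 a l
  simpa [wronskianMatrix] using prod_pow_mul_iterate_eulerOp f α (s a) l

variable {f}

theorem prod_pow_ne_zero (hf : ∀ j, f j ≠ 0) (i : Fin k) : ∏ j, f j ^ α i j ≠ 0 :=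
  Finset.prod_ne_zero_iff.2 fun j _ => pow_ne_zero _ (hf j)

theorem prod_prod_pow_ne_zero (hf : ∀ j, f j ≠ 0) (r : ℕ) :
    ∏ l : Fin r, (∏ j, f j) ^ (l : ℕ) ≠ 0 :=
  Finset.prod_ne_zero_iff.2 fun _ _ => pow_ne_zero _ (Finset.prod_ne_zero_iff.2 fun j _ => hf j)

theorem wronskian_eq_zero_iff (hf : ∀ j, f j ≠ 0) {r : ℕ} (s : Fin r → Fin k) :
    (wronskianMatrix fun a => ∏ j, f j ^ α (s a) j).det = 0 ↔ sparseWronskian f α s = 0 := by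
  have h := wronskian_prod_pow f α s
  have h1 := prod_prod_pow_ne_zero hf r
  have h2 : ∏ a, ∏ j, f j ^ α (s a) j ≠ 0 :=
    Finset.prod_ne_zero_iff.2 fun a _ => prod_pow_ne_zero α hf (s a)
  constructor
  · intro h0
    rw [h0, mul_zero] at h
    exact (mul_eq_zero.1 h.symm).resolve_left h2
  · intro h0
    rw [h0, mul_zero] at h
    exact (mul_eq_zero.1 h).resolve_left h1

/-- The subfamily given by `s` is a maximal linearly independent one, expressed by Wronskians. -/
def IsWronskianBasis (f : Fin m → Polynomial ℚ) (α : Fin k → Fin m → ℕ) {r : ℕ}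
    (s : Fin r → Fin k) : Prop :=
  sparseWronskian f α s ≠ 0 ∧ ∀ i, sparseWronskian f α (Fin.snoc s i : Fin (r + 1) → Fin k) = 0

theorem sparseWronskian_eq_zero_of_not_injective {r : ℕ} {s : Fin r → Fin k}
    (hs : ¬ Function.Injective s) : sparseWronskian f α s = 0 := by
  simp only [Function.Injective, not_forall] at hs
  obtain ⟨a, b, h, hab⟩ := hs
  exact Matrix.det_zero_of_row_eq hab (by ext1 l; simp [h])

theorem exists_isWronskianBasis (f : Fin m → Polynomial ℚ) (α : Fin k → Fin m → ℕ) :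
    ∃ (r : Fin (k + 1)) (s : Fin r → Fin k), IsWronskianBasis f α s := by
  -- Extend the empty family as long as possible.
  by_contra! hno
  have key : ∀ r ≤ k + 1, ∃ s : Fin r → Fin k, sparseWronskian f α s ≠ 0 := by
    intro r
    induction r with
    | zero => exact fun _ => ⟨Fin.elim0, by simp [sparseWronskian]⟩
    | succ r ih =>
      intro hr
      obtain ⟨s, hs⟩ := ih (by omega)
      have := hno ⟨r, by omega⟩ s
      simp only [IsWronskianBasis, not_and, not_forall] at this
      obtain ⟨i, hi⟩ := this hs
      exact ⟨_, hi⟩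
  obtain ⟨s, hs⟩ := key (k + 1) le_rfl
  refine hs (sparseWronskian_eq_zero_of_not_injective α fun h => ?_)
  simpa using Fintype.card_le_of_injective s h

/-- The criterion behind the algorithm. In terms of a basis, the coefficient of
`g i = ∏ j, f j ^ α i j` at the basis element `g (s a)` is the ratio of two Wronskians, and is
therefore determined by leading coefficients alone; these are multiplicative. -/
theorem IsWronskianBasis.sum_eq_zero_iff (hf : ∀ j, f j ≠ 0) {α : Fin k → Fin m → ℕ} {r : ℕ}
    {s : Fin r → Fin k} (hs : IsWronskianBasis f α s) :
    ∑ i, ∏ j, f j ^ α i j = 0 ↔ ∀ a, ∑ i, (∏ j, (f j).leadingCoeff ^ α i j) *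
      (sparseWronskian f α (Function.update s a i)).leadingCoeff = 0 := by
  have hW : (wronskianMatrix fun a => ∏ j, f j ^ α (s a) j).det ≠ 0 := fun h =>
    hs.1 ((wronskian_eq_zero_iff α hf s).1 h)
  choose c hc using fun i => exists_eq_sum_of_wronskian (z := ∏ j, f j ^ α i j) hW (by
    rw [← (wronskian_eq_zero_iff α hf _).2 (hs.2 i)]
    congr 2
    funext a
    induction a using Fin.lastCases <;> simp)
  have hratio : ∀ i a, (∏ j, f j ^ α i j) * sparseWronskian f α (Function.update s a i) =
      Polynomial.C (c i a) * (∏ j, f j ^ α (s a) j) * sparseWronskian f α s := by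
    intro i a
    have h1 := wronskian_update (fun a => ∏ j, f j ^ α (s a) j) (c i) a
    rw [← hc i] at h1
    have h2 := wronskian_prod_pow f α (Function.update s a i)
    have h3 := wronskian_prod_pow f α s
    have h4 : (fun b => ∏ j, f j ^ α (Function.update s a i b) j) =
        Function.update (fun a => ∏ j, f j ^ α (s a) j) a (∏ j, f j ^ α i j) := by
      funext b
      by_cases hb : b = a
      · subst hb; simp
      · simp [hb]
    rw [h4, h1, Finset.prod_update_of_mem (Finset.mem_univ a)] at h2
    rw [← Finset.prod_mul_prod_compl {a} fun a => ∏ j, f j ^ α (s a) j, Finset.prod_singleton,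
      Finset.compl_eq_univ_sdiff] at h3
    refine mul_left_cancel₀ (Finset.prod_ne_zero_iff.2 fun b _ => prod_pow_ne_zero α hf (s b) :
      ∏ b ∈ Finset.univ \ {a}, ∏ j, f j ^ α (s b) j ≠ 0) ?_
    linear_combination Polynomial.C (c i a) * h3 - h2
  have hlead : ∀ i a, (∏ j, (f j).leadingCoeff ^ α i j) *
      (sparseWronskian f α (Function.update s a i)).leadingCoeff =
      c i a * ((∏ j, f j ^ α (s a) j).leadingCoeff * (sparseWronskian f α s).leadingCoeff) := by
    intro i a
    have := congrArg Polynomial.leadingCoeff (hratio i a)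
    simpa [Polynomial.leadingCoeff_prod, mul_assoc] using this
  have hne : ∀ a, (∏ j, f j ^ α (s a) j).leadingCoeff * (sparseWronskian f α s).leadingCoeff ≠ 0 :=
    fun a => mul_ne_zero (Polynomial.leadingCoeff_ne_zero.2 (prod_pow_ne_zero α hf (s a)))
      (Polynomial.leadingCoeff_ne_zero.2 hs.1)
  have hsum : ∑ i, ∏ j, f j ^ α i j =
      ∑ a, Polynomial.C (∑ i, c i a) * ∏ j, f j ^ α (s a) j := by
    rw [Finset.sum_congr rfl fun i _ => hc i, Finset.sum_comm]
    simp only [map_sum, Finset.sum_mul]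
  simp only [hlead, ← Finset.sum_mul, mul_eq_zero, hne, or_false]
  rw [hsum]
  constructor
  · exact fun h a => eq_zero_of_sum_C_mul_eq_zero hW h a
  · intro h
    simp [h]

end Powers

/-! ### The size of the input -/

theorem Val.size_ofList_le {l : List Val} {B : ℕ} (h : ∀ v ∈ l, v.size ≤ B) :
    (ofList l).size ≤ l.length * (B + 1) + 1 := by
  rw [size_ofList]
  have := List.sum_le_card_nsmul (l.map fun v => v.size + 1) (B + 1) (by
    simpa using h)
  simpa using this

theorem SparseRep.Represents.length_le {L : SparseRep} {f : Polynomial ℚ} (h : L.Represents f) :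
    L.length ≤ f.support.card := by
  obtain ⟨hnd, hne, rfl⟩ := h
  rw [← List.length_map (f := Prod.fst), ← List.toFinset_card_of_nodup hnd]
  refine Finset.card_le_card fun e he => ?_
  obtain ⟨c, hc, rfl⟩ := List.mem_map.1 (List.mem_toFinset.1 he)
  -- As the exponents are distinct, `c` alone contributes to this coefficient.
  have key : ∀ L : SparseRep, (L.map Prod.fst).Nodup → c ∈ L →
      L.toPoly.coeff c.1 = c.2.toRat := by
    intro L
    induction L with
    | nil => simp
    | cons d L ih =>
      intro hnd hc
      rw [List.map_cons, List.nodup_cons] at hnd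
      rw [SparseRep.toPoly_cons, Polynomial.coeff_add, Polynomial.coeff_monomial]
      rcases List.mem_cons.1 hc with rfl | hc
      · have h0 : (SparseRep.toPoly L).coeff c.1 = 0 := by
          by_contra h0
          obtain ⟨d, hd, hdc⟩ := SparseRep.exists_mem_of_coeff_ne_zero h0
          exact hnd.1 (List.mem_map.2 ⟨d, hd, hdc⟩)
        simp [h0]
      · have hdc : d.1 ≠ c.1 := fun hdc => hnd.1 (List.mem_map.2 ⟨c, hc, hdc.symm⟩)
        rw [if_neg hdc, zero_add, ih hnd.2 hc]
  rw [Polynomial.mem_support_iff, key L hnd hc]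
  exact hne c hc

theorem SparseRep.size_encode_le {L : SparseRep} {t s : ℕ} (ht : L.length ≤ t)
    (hs : L.BitsizeLE s) : L.encode.size ≤ t * (3 * s + 6) + 1 := by
  have := size_ofList_le (l := L.map encodeTerm) (B := 3 * s + 5) (by
    intro v hv
    obtain ⟨c, hc, rfl⟩ := List.mem_map.1 hv
    obtain ⟨h1, h2, h3⟩ := hs c hc
    simp only [encodeTerm, Frac.encode, Val.size, Int.natAbs_natCast]
    omega)
  have h2 := Nat.mul_le_mul_right (3 * s + 5 + 1) ht
  rw [List.length_map] at this
  simp only [Nat.add_assoc, Nat.reduceAdd] at this h2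
  rw [encode_eq]
  omega

theorem size_encodeInput_le {k m t s : ℕ} {L : Fin m → SparseRep} {α : Fin k → Fin m → ℕ}
    (ht : ∀ j, (L j).length ≤ t) (hs : ∀ j, (L j).BitsizeLE s) (hα : ∀ i j, (α i j).size ≤ s) :
    (encodeInput L α).size ≤
      m * (t * (3 * s + 6) + 2) + k * (m * (s + 2) + 2) + 3 := by
  have h1 := size_ofList_le (l := List.ofFn fun j => (L j).encode) (B := t * (3 * s + 6) + 1) (by
    simpa [List.mem_ofFn] using fun j => SparseRep.size_encode_le (ht j) (hs j))
  have h2 := size_ofList_le (B := m * (s + 2) + 1)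
    (l := List.ofFn fun i => ofList (List.ofFn fun j => Val.num (α i j))) (by
      intro v hv
      obtain ⟨i, rfl⟩ := List.mem_ofFn.1 hv
      have := size_ofList_le (l := List.ofFn fun j => Val.num (α i j)) (B := s + 1) (by
        simpa [List.mem_ofFn, Val.size] using hα i)
      simpa using this)
  simp only [List.length_ofFn, Nat.add_assoc, Nat.reduceAdd] at h1 h2
  simp only [encodeInput, Val.size]
  omega

/-! ### The decision algorithm -/

section Algorithm

variable {k m : ℕ}

/-- The problem instances: sparse representations of the `f j`, and the exponents `α i j`. -/
abbrev Instance (k m : ℕ) : Type := (Fin m → SparseRep) × (Fin k → Fin m → ℕ)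

/-- `encodeInput` as a function of the whole instance. -/
def inputVal (x : Instance k m) : Val := encodeInput x.1 x.2

theorem sparsePolyTime_toPoly (j : Fin m) :
    SparsePolyTime inputVal fun x : Instance k m => (x.1 j).toPoly :=
  ⟨fun x => x.1 j, PolyTimeOn.of_ofList_ofFn (g := fun j _ (x : Instance k m) => (x.1 j).encode)
    ⟨_, PolyTime.fst .id, fun _ _ => rfl⟩ j, fun _ => rfl⟩

theorem polyTimeOn_exponent (i : Fin k) (j : Fin m) :
    PolyTimeOn inputVal fun _ (x : Instance k m) => .num (x.2 i j) :=
  PolyTimeOn.of_ofList_ofFn (g := fun j _ (x : Instance k m) => .num (x.2 i j))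
    (PolyTimeOn.of_ofList_ofFn (g := fun i _ (x : Instance k m) =>
      ofList (List.ofFn fun j => .num (x.2 i j)))
      ⟨_, PolyTime.snd .id, fun _ _ => rfl⟩ i) j

theorem sparsePolyTime_derivFactor (i : Fin k) (l : ℕ) :
    SparsePolyTime inputVal fun x : Instance k m =>
      derivFactor (fun j => (x.1 j).toPoly) x.2 i l := by
  have hF : SparsePolyTime inputVal fun x : Instance k m =>
      ∏ j, (x.1 j).toPoly := .prod _ fun j => sparsePolyTime_toPoly j
  have hA : SparsePolyTime inputVal fun x : Instance k m =>
      logDerivNum (fun j => (x.1 j).toPoly) x.2 i :=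
    .sum _ fun j => .mul (.mul (.C_intCast (polyTimeOn_exponent i j))
      (.euler (sparsePolyTime_toPoly j))) (.prod _ fun j' => sparsePolyTime_toPoly j')
  induction l with
  | zero => simpa [derivFactor] using SparsePolyTime.intCast 1
  | succ l ih =>
    exact .add (.mul (.add hA (.mul (.C_intCast (.const _)) (.euler hF))) ih)
      (.mul hF (.euler ih))

theorem sparsePolyTime_sparseWronskian {r : ℕ} (s : Fin r → Fin k) :
    SparsePolyTime inputVal fun x : Instance k m =>
      sparseWronskian (fun j => (x.1 j).toPoly) x.2 s :=
  .det fun a b => sparsePolyTime_derivFactor (s a) b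

/-- For a basis `s` and a position `a`, one oracle query decides whether the coefficient sum at
`s a` vanishes. -/
theorem exists_query {r : ℕ} (s : Fin r → Fin k) (a : Fin r) :
    ∃ b : (Val → Bool) → Instance k m → Bool,
      PolyTimeOn inputVal (fun O x => .ofBool (b O x)) ∧
      ∀ O, DecidesConstantIdentities k (m + 1) O → ∀ x, b O x = true ↔
        ∑ i, (∏ j, (x.1 j).toPoly.leadingCoeff ^ x.2 i j) * (sparseWronskian
          (fun j => (x.1 j).toPoly) x.2 (Function.update s a i)).leadingCoeff = 0 := by
  choose A hA hA' using fun j : Fin m => (sparsePolyTime_toPoly (k := k) j).exists_leadFrac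
  choose B hB hB' using fun i : Fin k =>
    (sparsePolyTime_sparseWronskian (m := m) (Function.update s a i)).exists_leadFrac
  refine ⟨fun O x => O (encodeQuery
    (fun i => (Fin.snoc (fun j => A j x) (B i x) : Fin (m + 1) → Frac))
    (fun i => (Fin.snoc (x.2 i) 1 : Fin (m + 1) → ℕ))), ?_, fun O hO x => ?_⟩
  · refine PolyTimeOn.query (PolyTimeOn.ofList_ofFn fun i => PolyTimeOn.ofList_ofFn fun j => ?_)
    induction j using Fin.lastCases with
    | last => simpa using PolyTimeOn.pair (hB i) (.const (.num 1))
    | cast j => simpa using PolyTimeOn.pair (hA j) (polyTimeOn_exponent i j)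
  · refine (hO _ _).trans ?_
    simp [Fin.prod_univ_castSucc, hA', hB']

/-- The algorithm: over all subfamilies `s` that are bases, all queries have to be answered
positively. -/
theorem exists_decision (k m : ℕ) :
    ∃ b : (Val → Bool) → Instance k m → Bool,
      PolyTimeOn inputVal (fun O x => .ofBool (b O x)) ∧
      ∀ O, DecidesConstantIdentities k (m + 1) O → ∀ x, (∀ j, (x.1 j).toPoly ≠ 0) →
        (b O x = true ↔ ∑ i, ∏ j, (x.1 j).toPoly ^ x.2 i j = 0) := by
  choose q hq hq' using fun (r : Fin (k + 1)) (s : Fin r → Fin k) (a : Fin r) =>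
    exists_query (m := m) s a
  let z (n : ℕ) (s : Fin n → Fin k) (x : Instance k m) : Bool :=
    decide (sparseWronskian (fun j => (x.1 j).toPoly) x.2 s = 0)
  have hz : ∀ n s, PolyTimeOn inputVal fun _ x => .ofBool (z n s x) := fun n s =>
    (sparsePolyTime_sparseWronskian s).eq_zero
  -- Every basis gives the same answer, so none has to be singled out.
  refine ⟨_, PolyTimeOn.forall_fintype fun r : Fin (k + 1) =>
    PolyTimeOn.forall_fintype fun s : Fin r → Fin k => .not (.and
      (.and (.not (hz r s)) (.forall_fintype fun i => hz (r + 1) (Fin.snoc s i)))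
      (.not (.forall_fintype fun a => hq r s a))), fun O hO x hx => ?_⟩
  have key : ∀ (r : Fin (k + 1)) (s : Fin r → Fin k),
      IsWronskianBasis (fun j => (x.1 j).toPoly) x.2 s →
      ((∀ a, q r s a O x = true) ↔ ∑ i, ∏ j, (x.1 j).toPoly ^ x.2 i j = 0) := by
    intro r s hs
    rw [hs.sum_eq_zero_iff hx]
    exact forall_congr' fun a => hq' r s a O hO x
  have hb : ∀ (r : Fin (k + 1)) (s : Fin r → Fin k),
      IsWronskianBasis (fun j => (x.1 j).toPoly) x.2 s ↔
        z r s x = false ∧ ∀ i, z (r + 1) (Fin.snoc s i) x = true := by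
    intro r s
    simp [IsWronskianBasis, z]
  have hmain : (∀ (r : Fin (k + 1)) (s : Fin r → Fin k),
      IsWronskianBasis (fun j => (x.1 j).toPoly) x.2 s → ∀ a, q r s a O x = true) ↔
      ∑ i, ∏ j, (x.1 j).toPoly ^ x.2 i j = 0 := by
    constructor
    · intro h
      obtain ⟨r, s, hs⟩ := exists_isWronskianBasis (fun j => (x.1 j).toPoly) x.2
      exact (key r s hs).1 (h r s hs)
    · exact fun h r s hs => (key r s hs).2 h
  rw [← hmain]
  simp only [hb, decide_eq_true_eq]
  refine forall_congr' fun r => forall_congr' fun s => ?_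
  simp [or_iff_not_imp_left]

end Algorithm

theorem mainTheorem5 (k m : ℕ) :
    ∃ (p : Prog) (Q : Polynomial ℕ),
      ∀ O : Val → Bool, DecidesConstantIdentities k (m + 1) O →
        ∀ (t s : ℕ) (f : Fin m → Polynomial ℚ) (L : Fin m → SparseRep) (α : Fin k → Fin m → ℕ),
          (∀ j, f j ≠ 0) →
          (∀ j, (L j).Represents (f j)) →
          (∀ j, (f j).support.card ≤ t) →
          (∀ j, (L j).BitsizeLE s) →
          (∀ i j, (α i j).size ≤ s) →
          ∃ (σ : Store) (T : ℕ),
            Exec O p (Store.init (encodeInput L α)) σ T ∧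
            T ≤ Q.eval (t + s) ∧
            (∑ i, ∏ j, f j ^ α i j = 0 → σ 0 = Val.num 1) ∧
            (∑ i, ∏ j, f j ^ α i j ≠ 0 → σ 0 = Val.num 0) := by
  obtain ⟨b, ⟨F, ⟨p, n, P, hp⟩, hF⟩, hb⟩ := exists_decision k m
  let R : Polynomial ℕ := (m : Polynomial ℕ) * (.X * (3 * .X + 6) + 2) +
    (k : Polynomial ℕ) * ((m : Polynomial ℕ) * (.X + 2) + 2) + 3
  refine ⟨p, P.comp R, fun O hO t s f L α hf hL ht hs hα => ?_⟩
  obtain ⟨σ, T, hexec, hout, -, hT, -⟩ := hp O (Store.init (encodeInput L α))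
  have h0 : Store.init (encodeInput L α) 0 = inputVal (L, α) := by simp [Store.init, inputVal]
  have hLf : ∀ j, (L j).toPoly = f j := fun j => (hL j).2.2
  have hdec := hb O hO (L, α) (fun j => by simpa [hLf j] using hf j)
  simp only [hLf] at hdec
  rw [h0, hF] at hout
  change σ 0 = .ofBool (b O (L, α)) at hout
  refine ⟨σ, T, hexec, hT.trans ?_, fun h => ?_, fun h => ?_⟩
  · rw [Polynomial.eval_comp, h0]
    refine P.eval_nat_mono ((size_encodeInput_le (fun j => (hL j).length_le.trans (ht j)) hs
      hα).trans ?_)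
    simp only [R, Polynomial.eval_add, Polynomial.eval_mul, Polynomial.eval_natCast,
      Polynomial.eval_X, Polynomial.eval_ofNat]
    gcongr <;> simp
  · rw [hout, hdec.2 h]
    rfl
  · rw [hout, Bool.eq_false_iff.2 fun h' => h (hdec.1 h')]
    rfl
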